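/- Let $\Pi=\{s\in\mathbb C:\operatorname{Re}s>0\}$ and let $G\subset\mathbb C$ be a domain (a nonempty connected open set) with convex hull $\widetilde G$. A regular point of convexity of $G$ is a point $p\in\partial G\cap\partial\widetilde G$ for which there is an open disk $U\subset G$ of positive radius with $p\in\partial U$. The isometric Bohr abscissa $\mathbf b(G)$ is the infimum of those $\sigma\ge 0$ such that $$\sum_{n=2}^\infty\frac{|a_n|}{n^{\sigma}}<\operatorname{dist}(a_1,\partial\widetilde G)$$ for every Dirichlet series $f(s)=\sum_{n=1}^\infty a_n n^{-s}$ that converges in $\Pi$, is bounded on $\Pi$ and satisfies $f(\Pi)\subset G$. The abscissa $\mathbf b_a(G)$ is defined in the same way, but with the series $f(s)=\sum_{n=1}^\infty a_n n^{-s}$ that converge absolutely at every point of $\Pi$ and satisfy $f(\Pi)\subset G$. Assume that $\partial G$ contains at least one regular point of convexity. If $G$ is bounded, then $$\frac{\log 3}{\log 2}\le \mathbf b(G)<1.7267 .$$ Whether or not $G$ is bounded, $$\frac{\log 3}{\log 2}\le \mathbf b_a(G)<1.7267 ,$$ and these bounds hold both if, in the definition of $\mathbf b_a(G)$, $f$ is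 not required to be bounded on $\Pi$ and if it is. -/

import Mathlib

namespace BohrDirichlet

open Filter Topology

/-- The open right half-plane `Π = {s : Re s > 0}`. -/
def rightHalfPlane : Set ℂ := {s | 0 < s.re}

/-- On `Π` the function `f` is the sum of the (possibly only conditionally) convergent Dirichlet
series `∑_{n ≥ 1} a n / n ^ s`. The value `a 0` plays no role. -/
def HasDirichletSeries (f : ℂ → ℂ) (a : ℕ → ℂ) : Prop :=
  ∀ s ∈ rightHalfPlane,
    Tendsto (fun N : ℕ => ∑ n ∈ Finset.Icc 1 N, a n / (n : ℂ) ^ s) atTop (𝓝 (f s))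

/-- The Dirichlet series `∑_{n ≥ 1} a n / n ^ s` converges absolutely at every point of `Π`. -/
def ConvergesAbsolutely (a : ℕ → ℂ) : Prop :=
  ∀ s ∈ rightHalfPlane, Summable (fun n : ℕ => ‖a (n + 1) / ((n + 1 : ℕ) : ℂ) ^ s‖)

/-- `f` belongs to `H^∞(Π)`: it is holomorphic and bounded on `Π`. -/
def MemHInfty (f : ℂ → ℂ) : Prop :=
  DifferentiableOn ℂ f rightHalfPlane ∧ ∃ C : ℝ, ∀ s ∈ rightHalfPlane, ‖f s‖ ≤ C

/-- The inequality `∑_{n ≥ 2} |a n| / n ^ σ < dist (a 1, ∂ (convex hull of G))`, which includes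
the convergence of the series on the left. -/
def BohrInequality (G : Set ℂ) (a : ℕ → ℂ) (σ : ℝ) : Prop :=
  Summable (fun n : ℕ => ‖a (n + 2)‖ / ((n + 2 : ℕ) : ℝ) ^ σ) ∧
    ∑' n : ℕ, ‖a (n + 2)‖ / ((n + 2 : ℕ) : ℝ) ^ σ
      < Metric.infDist (a 1) (frontier (convexHull ℝ G))

/-- The isometric Bohr abscissa `b(G)`. -/
noncomputable def bohrAbscissa (G : Set ℂ) : ℝ :=
  sInf {σ : ℝ | 0 ≤ σ ∧ ∀ (f : ℂ → ℂ) (a : ℕ → ℂ), HasDirichletSeries f a → MemHInfty f →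
    Set.MapsTo f rightHalfPlane G → BohrInequality G a σ}

/-- The abscissa `b_a(G)`, over all Dirichlet series that converge absolutely in `Π`; the sum is
not required to be bounded. -/
noncomputable def bohrAbscissaAbs (G : Set ℂ) : ℝ :=
  sInf {σ : ℝ | 0 ≤ σ ∧ ∀ (f : ℂ → ℂ) (a : ℕ → ℂ), HasDirichletSeries f a →
    ConvergesAbsolutely a → Set.MapsTo f rightHalfPlane G → BohrInequality G a σ}

/-- The variant of `b_a(G)` over the Dirichlet series that converge absolutely in `Π` and whose
sum belongs to `H^∞(Π)`. -/
noncomputable def bohrAbscissaAbsBounded (G : Set ℂ) : ℝ :=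
  sInf {σ : ℝ | 0 ≤ σ ∧ ∀ (f : ℂ → ℂ) (a : ℕ → ℂ), HasDirichletSeries f a →
    ConvergesAbsolutely a → MemHInfty f → Set.MapsTo f rightHalfPlane G → BohrInequality G a σ}

/-- `p ∈ ∂G` is a point of convexity: it lies on the boundary of the convex hull of `G`. -/
def IsPointOfConvexity (G : Set ℂ) (p : ℂ) : Prop :=
  p ∈ frontier G ∧ p ∈ frontier (convexHull ℝ G)

/-- A point of convexity is regular if it lies on the boundary of some open disk contained
in `G`. -/
def IsRegularPointOfConvexity (G : Set ℂ) (p : ℂ) : Prop :=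
  IsPointOfConvexity G p ∧
    ∃ (c : ℂ) (r : ℝ), 0 < r ∧ Metric.ball c r ⊆ G ∧ p ∈ frontier (Metric.ball c r)

end BohrDirichlet

namespace BohrDirichlet

open Filter Topology ComplexConjugate ArithmeticFunction

/-! Upper bound. If `q` is a point of the boundary of the convex hull nearest to `a 1`, a supporting
half-plane at `q` gives `u` such that `g = u * (f - q)` has positive real part on the half-plane.
Its coefficients are `u * (a 1 - q)` and `u * a n` for `n ≥ 2`, so it suffices to bound the
coefficients of a series with positive real part by that of `n = 1`. Write `R` for the real part of
that coefficient.

Averaging `g` against squared Dirichlet polynomials on vertical lines makes the multiplicative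
Toeplitz form of the coefficients nonnegative (`isMulToeplitzNonneg_of_re_nonneg`). Testing the form
on the divisors of `N!` with unimodular characters, and grading by `Ω(n)` (`cardFactors`), yields
Carathéodory's bound `2R` for every homogeneous part. Hence the `ℓ¹` norm over primes is at most
`2R` (`sum_primes_norm_le`), and so is the `ℓ²` norm over `Ω(n) = k` for each `k ≥ 1`
(`sum_sq_norm_le`). With `P` the sum of `p ^ (-2σ)` over primes, Cauchy–Schwarz bounds the Bohr sum
by `2R (2 ^ (-σ) + ∑_{k ≥ 2} P ^ (k/2))`, which is at most `0.99 R` at `σ = 69/40 = 1.725`. The `ℓ¹`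
bound matters: with `P ^ (1/2)` in place of `2 ^ (-σ)` the total would exceed `R`.

Lower bound. A disc automorphism in the variable `2 ^ (-s)`, mapped into the disc touching the
regular point, violates the strict inequality whenever `2 ^ σ < 3` (`log_three_div_log_two_le`). -/

/-! ### Mean values of trigonometric polynomials -/

theorem tendsto_mean_exp (θ : ℝ) :
    Tendsto (fun T : ℝ => (T : ℂ)⁻¹ * ∫ t in (0 : ℝ)..T, Complex.exp (θ * t * Complex.I)) atTop
      (𝓝 (if θ = 0 then 1 else 0)) := by
  split_ifs with h
  · refine tendsto_const_nhds.congr' ?_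
    filter_upwards [eventually_gt_atTop 0] with T hT
    have hT' : (T : ℂ) ≠ 0 := by exact_mod_cast hT.ne'
    simp [h, hT']
  · have hθ : (θ : ℂ) * Complex.I ≠ 0 := by simp [h]
    have hb : ∀ T : ℝ, ‖∫ t in (0 : ℝ)..T, Complex.exp (θ * t * Complex.I)‖ ≤ 2 / |θ| := by
      intro T
      have : ∀ t : ℝ, Complex.exp (θ * t * Complex.I) = Complex.exp (θ * Complex.I * t) :=
        fun t => by ring_nf
      simp_rw [this]
      rw [integral_exp_mul_complex hθ, norm_div]
      simp only [norm_mul, Complex.norm_real, Complex.norm_I, mul_one, Real.norm_eq_abs]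
      gcongr
      refine (norm_sub_le _ _).trans ?_
      have h1 : (θ : ℂ) * Complex.I * T = ((θ * T : ℝ) : ℂ) * Complex.I := by push_cast; ring
      rw [h1, Complex.norm_exp_ofReal_mul_I]
      simp
      norm_num
    rw [tendsto_zero_iff_norm_tendsto_zero]
    have h0 : Tendsto (fun T : ℝ => T⁻¹ * (2 / |θ|)) atTop (𝓝 0) := by
      simpa using tendsto_inv_atTop_zero.mul_const (2 / |θ|)
    refine squeeze_zero' (Eventually.of_forall fun _ => norm_nonneg _) ?_ h0
    filter_upwards [eventually_gt_atTop 0] with T hT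
    rw [norm_mul, norm_inv, Complex.norm_real, Real.norm_of_nonneg hT.le]
    gcongr
    exact hb T

theorem continuous_exp_mul_I (θ : ℝ) :
    Continuous fun t : ℝ => Complex.exp (θ * t * Complex.I) := by fun_prop

/-- If the limit of the means of a function with nonnegative real part exists, it has nonnegative
real part. -/
theorem re_nonneg_of_tendsto_mean {g : ℝ → ℂ} {z : ℂ} (hg : Continuous g) (h : ∀ t, 0 ≤ (g t).re)
    (hz : Tendsto (fun T : ℝ => (T : ℂ)⁻¹ * ∫ t in (0 : ℝ)..T, g t) atTop (𝓝 z)) : 0 ≤ z.re := by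
  refine ge_of_tendsto ((Complex.continuous_re.tendsto z).comp hz) ?_
  filter_upwards [eventually_gt_atTop 0] with T hT
  have h1 : (∫ t in (0 : ℝ)..T, g t).re = ∫ t in (0 : ℝ)..T, (g t).re := by
    have := Complex.reCLM.intervalIntegral_comp_comm (hg.intervalIntegrable (μ := MeasureTheory.volume) 0 T)
    simpa using this.symm
  have h2 : 0 ≤ (∫ t in (0 : ℝ)..T, g t).re := by
    rw [h1]
    exact intervalIntegral.integral_nonneg hT.le fun t _ => h t
  simp only [Function.comp, ← Complex.ofReal_inv, Complex.re_ofReal_mul]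
  positivity

/-- The constant part of a trigonometric polynomial with nonnegative real part has nonnegative
real part. -/
theorem re_sum_nonneg_of_trig {ι : Type*} (s : Finset ι) (c : ι → ℂ) (θ : ι → ℝ)
    (h : ∀ t : ℝ, 0 ≤ (∑ j ∈ s, c j * Complex.exp (θ j * t * Complex.I)).re) :
    0 ≤ (∑ j ∈ s, if θ j = 0 then c j else 0).re := by
  refine re_nonneg_of_tendsto_mean
    (g := fun t => ∑ j ∈ s, c j * Complex.exp (θ j * t * Complex.I)) (by fun_prop) h ?_
  have h1 : ∀ T : ℝ, (T : ℂ)⁻¹ * ∫ t in (0 : ℝ)..T, ∑ j ∈ s, c j * Complex.exp (θ j * t * Complex.I)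
      = ∑ j ∈ s, c j * ((T : ℂ)⁻¹ * ∫ t in (0 : ℝ)..T, Complex.exp (θ j * t * Complex.I)) := by
    intro T
    rw [intervalIntegral.integral_finsetSum, Finset.mul_sum]
    · refine Finset.sum_congr rfl fun j _ => ?_
      rw [intervalIntegral.integral_const_mul]; ring
    · intro j _
      exact ((continuous_exp_mul_I (θ j)).const_mul _).intervalIntegrable _ _
  simp_rw [h1]
  have : ∀ j, (if θ j = 0 then c j else 0) = c j * (if θ j = 0 then 1 else 0) := by
    intro j; split_ifs <;> simp
  simp_rw [this]
  exact tendsto_finsetSum _ fun j _ => (tendsto_mean_exp (θ j)).const_mul _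

/-- Carathéodory's coefficient bound. Multiplying by the nonnegative kernel `1 + Re (c * exp
(-ikt))`, with `|c| = 1` rotating the `k`-th coefficient `B` to `-‖B‖`, and taking means leaves the
constant term minus `‖B‖ / 2`. The conjugate half of the kernel contributes nothing, because all
frequencies `w j` are nonnegative and `k > 0`. -/
theorem norm_sum_le_of_re_nonneg {ι : Type*} (s : Finset ι) (u : ι → ℂ) (w : ι → ℕ)
    (h : ∀ t : ℝ, 0 ≤ (∑ j ∈ s, u j * Complex.exp ((w j : ℝ) * t * Complex.I)).re)
    {k : ℕ} (hk : k ≠ 0) :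
    ‖∑ j ∈ s with w j = k, u j‖ ≤ 2 * (∑ j ∈ s with w j = 0, u j).re := by
  set B := ∑ j ∈ s with w j = k, u j with hB
  obtain ⟨c, hc, hcB⟩ : ∃ c : ℂ, ‖c‖ = 1 ∧ c * B = -(‖B‖ : ℂ) := by
    by_cases h0 : B = 0
    · exact ⟨1, by simp, by simp [h0]⟩
    · have h1 : (‖B‖ : ℂ) ≠ 0 := by simpa using h0
      refine ⟨-(conj B / ‖B‖), by simp [h0], ?_⟩
      have := Complex.conj_mul' B
      field_simp
      linear_combination -this
  let d : Fin 3 → ℂ := ![1, c / 2, conj c / 2]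
  let e : Fin 3 → ℝ := ![0, -k, k]
  have key := re_sum_nonneg_of_trig (s ×ˢ (Finset.univ : Finset (Fin 3)))
    (fun x => u x.1 * d x.2) (fun x => (w x.1 : ℝ) + e x.2) ?_
  · rw [Finset.sum_product] at key
    simp only [Fin.sum_univ_three] at key
    rw [Finset.sum_add_distrib, Finset.sum_add_distrib] at key
    have h1 : ∑ j ∈ s, (if (w j : ℝ) + e 0 = 0 then u j * d 0 else 0)
        = ∑ j ∈ s with w j = 0, u j := by
      rw [Finset.sum_filter]
      refine Finset.sum_congr rfl fun j _ => ?_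
      have : (w j : ℝ) + e 0 = 0 ↔ w j = 0 := by simp [e]
      simp only [this]
      simp [d]
    have h2 : ∑ j ∈ s, (if (w j : ℝ) + e 1 = 0 then u j * d 1 else 0) = c * B / 2 := by
      rw [hB, Finset.sum_filter, Finset.mul_sum, Finset.sum_div]
      refine Finset.sum_congr rfl fun j _ => ?_
      have : (w j : ℝ) + e 1 = 0 ↔ w j = k := by
        simp only [e, Matrix.cons_val_one, Matrix.cons_val_zero]
        rw [← sub_eq_add_neg, sub_eq_zero, Nat.cast_inj]
      simp only [this, d, Matrix.cons_val_one, Matrix.cons_val_zero]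
      split_ifs <;> ring
    have h3 : ∑ j ∈ s, (if (w j : ℝ) + e 2 = 0 then u j * d 2 else 0) = 0 := by
      refine Finset.sum_eq_zero fun j _ => if_neg ?_
      have : (0 : ℝ) < k := by exact_mod_cast Nat.pos_of_ne_zero hk
      have h4 : e 2 = k := by simp [e]
      rw [h4]
      positivity
    rw [h1, h2, h3, hcB, add_zero, Complex.add_re] at key
    have h4 : (-(‖B‖ : ℂ) / 2).re = -‖B‖ / 2 := by simp
    linarith
  · intro t
    have hpos : 0 ≤ 1 + (c * Complex.exp (-(k * t) * Complex.I)).re := by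
      have := Complex.abs_re_le_norm (c * Complex.exp (-(k * t) * Complex.I))
      have h2 : (-(k * t) * Complex.I : ℂ) = ((-(k * t) : ℝ) : ℂ) * Complex.I := by push_cast; ring
      rw [norm_mul, hc, h2, Complex.norm_exp_ofReal_mul_I] at this
      rw [h2]
      linarith [abs_le.1 this]
    have hK : ∑ j : Fin 3, d j * Complex.exp ((e j : ℝ) * t * Complex.I)
        = ((1 + (c * Complex.exp (-(k * t) * Complex.I)).re : ℝ) : ℂ) := by
      push_cast
      rw [Complex.re_eq_add_conj, map_mul, ← Complex.exp_conj]
      simp [d, e, Fin.sum_univ_three]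
      ring_nf
    have : ∑ x ∈ s ×ˢ (Finset.univ : Finset (Fin 3)),
        u x.1 * d x.2 * Complex.exp ((((w x.1 : ℝ) + e x.2 : ℝ) : ℂ) * t * Complex.I)
        = (∑ j ∈ s, u j * Complex.exp ((w j : ℝ) * t * Complex.I)) *
          ∑ j : Fin 3, d j * Complex.exp ((e j : ℝ) * t * Complex.I) := by
      rw [Finset.sum_mul_sum, Finset.sum_product]
      refine Finset.sum_congr rfl fun i _ => Finset.sum_congr rfl fun j _ => ?_
      push_cast
      rw [add_mul, add_mul, Complex.exp_add]
      ring
    rw [this, hK, Complex.re_mul_ofReal]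
    exact mul_nonneg (h t) hpos

/-- Bessel's inequality for Dirichlet polynomials bounded on a vertical line. -/
theorem sum_sq_norm_le_of_norm_le (s : Finset ℕ) (hs : ∀ n ∈ s, n ≠ 0) (v : ℕ → ℂ) {M : ℝ}
    (h : ∀ t : ℝ, ‖∑ n ∈ s, v n * Complex.exp (Real.log n * t * Complex.I)‖ ≤ M) :
    ∑ n ∈ s, ‖v n‖ ^ 2 ≤ M ^ 2 := by
  -- These are the coefficients and frequencies of `M ^ 2 - |P| ^ 2 ≥ 0`, with `none` indexing the
  -- constant `M ^ 2`. Injectivity of `log` leaves only the diagonal in the mean.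
  let c : Option (ℕ × ℕ) → ℂ := fun o => o.elim ((M : ℂ) ^ 2) fun x => -(v x.1 * conj (v x.2))
  let e : Option (ℕ × ℕ) → ℝ := fun o => o.elim 0 fun x => Real.log x.1 - Real.log x.2
  have key := re_sum_nonneg_of_trig (Finset.insertNone (s ×ˢ s)) c e ?_
  · rw [Finset.sum_insertNone, Finset.sum_product] at key
    have h1 : ∑ m ∈ s, ∑ n ∈ s, (if e (some (m, n)) = 0 then c (some (m, n)) else 0)
        = -((∑ n ∈ s, ‖v n‖ ^ 2 : ℝ) : ℂ) := by
      push_cast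
      rw [← Finset.sum_neg_distrib]
      refine Finset.sum_congr rfl fun m hm => ?_
      rw [Finset.sum_eq_single m]
      · simp [e, c, Complex.mul_conj']
      · intro n hn hnm
        refine if_neg fun h0 => hnm ?_
        have hm' : (0 : ℝ) < m := by exact_mod_cast Nat.pos_of_ne_zero (hs m hm)
        have hn' : (0 : ℝ) < n := by exact_mod_cast Nat.pos_of_ne_zero (hs n hn)
        have := Real.log_injOn_pos hm' hn' (sub_eq_zero.1 h0)
        exact_mod_cast this.symm
      · exact fun h => absurd hm h
    rw [h1] at key
    simp only [e, c, Option.elim, if_true, Complex.add_re, Complex.neg_re, Complex.ofReal_re,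
      ← Complex.ofReal_pow] at key
    linarith
  · intro t
    rw [Finset.sum_insertNone, Finset.sum_product]
    set P := ∑ n ∈ s, v n * Complex.exp (Real.log n * t * Complex.I) with hP
    have h1 : ∑ m ∈ s, ∑ n ∈ s, c (some (m, n)) * Complex.exp (e (some (m, n)) * t * Complex.I)
        = -((‖P‖ ^ 2 : ℝ) : ℂ) := by
      rw [Complex.ofReal_pow, ← Complex.mul_conj', hP, map_sum, Finset.sum_mul_sum,
        ← Finset.sum_neg_distrib]
      refine Finset.sum_congr rfl fun m _ => ?_
      rw [← Finset.sum_neg_distrib]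
      refine Finset.sum_congr rfl fun n _ => ?_
      simp only [e, c, Option.elim, map_mul, ← Complex.exp_conj, Complex.conj_ofReal,
        Complex.conj_I]
      have : (((Real.log m - Real.log n : ℝ)) : ℂ) * t * Complex.I
        = Real.log m * t * Complex.I + Real.log n * t * -Complex.I := by push_cast; ring
      rw [this, Complex.exp_add]
      ring
    rw [h1]
    simp only [e, c, Option.elim, Complex.ofReal_zero, zero_mul, Complex.exp_zero, mul_one,
      Complex.add_re, Complex.neg_re, Complex.ofReal_re, ← Complex.ofReal_pow]
    have := pow_le_pow_left₀ (norm_nonneg _) (h t) 2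
    linarith

/-! ### Multiplicative Toeplitz forms tested on divisors -/

/-- The multiplicative Toeplitz form of `a` has nonnegative real part. -/
def IsMulToeplitzNonneg (a : ℕ → ℂ) : Prop :=
  ∀ (S : Finset ℕ) (z : ℕ → ℂ), (∀ m ∈ S, m ≠ 0) →
    0 ≤ (∑ m ∈ S, ∑ l ∈ S, if l ∣ m then z m * conj (z l) * a (m / l) else 0).re

/-- A completely multiplicative function with values in the unit circle. -/
structure IsUnimodularChar (χ : ℕ → ℂ) : Prop where
  map_mul : ∀ m n, m ≠ 0 → n ≠ 0 → χ (m * n) = χ m * χ n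
  norm_eq_one : ∀ n, n ≠ 0 → ‖χ n‖ = 1

theorem IsUnimodularChar.map_one {χ : ℕ → ℂ} (h : IsUnimodularChar χ) : χ 1 = 1 := by
  have h1 := h.map_mul 1 1 one_ne_zero one_ne_zero
  have h2 : χ 1 ≠ 0 := by
    rw [← norm_ne_zero_iff, h.norm_eq_one 1 one_ne_zero]; exact one_ne_zero
  rw [mul_one] at h1
  exact (mul_left_cancel₀ h2 (by rw [mul_one, ← h1])).symm

theorem IsUnimodularChar.mul {χ ψ : ℕ → ℂ} (h : IsUnimodularChar χ) (h' : IsUnimodularChar ψ) :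
    IsUnimodularChar fun n => χ n * ψ n where
  map_mul m n hm hn := by rw [h.map_mul m n hm hn, h'.map_mul m n hm hn]; ring
  norm_eq_one n hn := by rw [norm_mul, h.norm_eq_one n hn, h'.norm_eq_one n hn, mul_one]

theorem isUnimodularChar_cardFactors (t : ℝ) :
    IsUnimodularChar fun n => Complex.exp ((cardFactors n : ℝ) * t * Complex.I) where
  map_mul m n hm hn := by
    rw [cardFactors_mul hm hn, ← Complex.exp_add]; push_cast; ring_nf
  norm_eq_one n _ := by rw [← Complex.ofReal_mul, Complex.norm_exp_ofReal_mul_I]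

theorem isUnimodularChar_log (t : ℝ) :
    IsUnimodularChar fun n => Complex.exp (Real.log n * t * Complex.I) where
  map_mul m n hm hn := by
    rw [Nat.cast_mul, Real.log_mul (by exact_mod_cast hm) (by exact_mod_cast hn),
      ← Complex.exp_add]
    push_cast; ring_nf
  norm_eq_one n _ := by rw [← Complex.ofReal_mul, Complex.norm_exp_ofReal_mul_I]

theorem exists_isUnimodularChar (z : ℕ → ℂ) (hz : ∀ n, ‖z n‖ = 1) :
    ∃ χ, IsUnimodularChar χ ∧ ∀ p, p.Prime → χ p = z p := by
  refine ⟨fun n => n.factorization.prod fun p k => z p ^ k, ⟨?_, ?_⟩, ?_⟩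
  · intro m n hm hn
    rw [Nat.factorization_mul hm hn, Finsupp.prod_add_index' (by simp)
      fun p k l => pow_add _ _ _]
  · intro n _
    simp [Finsupp.prod, norm_prod, hz]
  · intro p hp
    simp [hp.factorization]

/-- The proportion of the divisors `d` of `D` for which `n * d` is again a divisor. -/
noncomputable def divisorDensity (D n : ℕ) : ℝ := ((D / n).divisors.card : ℝ) / D.divisors.card

theorem divisorDensity_nonneg (D n : ℕ) : 0 ≤ divisorDensity D n := by
  unfold divisorDensity; positivity

theorem divisorDensity_one {D : ℕ} (hD : D ≠ 0) : divisorDensity D 1 = 1 := by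
  unfold divisorDensity
  rw [Nat.div_one, div_self]
  simpa using hD

theorem card_divisors_filter_dvd {D n : ℕ} (hD : D ≠ 0) (hn : n ∣ D) :
    (D.divisors.filter (n ∣ ·)).card = (D / n).divisors.card := by
  obtain ⟨e, rfl⟩ := hn
  have hn0 : n ≠ 0 := by rintro rfl; simp at hD
  have he : e ≠ 0 := by rintro rfl; simp at hD
  rw [Nat.mul_div_cancel_left _ (Nat.pos_of_ne_zero hn0)]
  symm
  refine Finset.card_bij (fun l _ => n * l) ?_ ?_ ?_
  · intro l hl
    simp only [Finset.mem_filter, Nat.mem_divisors] at hl ⊢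
    exact ⟨⟨mul_dvd_mul_left n hl.1, hD⟩, dvd_mul_right _ _⟩
  · intro l _ l' _ h
    exact Nat.eq_of_mul_eq_mul_left (Nat.pos_of_ne_zero hn0) h
  · intro m hm
    simp only [Finset.mem_filter, Nat.mem_divisors] at hm
    obtain ⟨l, rfl⟩ := hm.2
    exact ⟨l, by simpa [he] using Nat.dvd_of_mul_dvd_mul_left (Nat.pos_of_ne_zero hn0) hm.1.1, rfl⟩

/-- With test vector `χ` on the divisors of `D`, the factor `χ m * conj (χ l)` is `χ (m / l)`, so
the form depends on `n = m / l` alone. Each `n` occurs once for every divisor `m` of `D` that is a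
multiple of `n`, which produces the density. -/
theorem IsMulToeplitzNonneg.re_sum_divisors_nonneg {a : ℕ → ℂ} (ha : IsMulToeplitzNonneg a)
    {χ : ℕ → ℂ} (hχ : IsUnimodularChar χ) {D : ℕ} (hD : D ≠ 0) :
    0 ≤ (∑ n ∈ D.divisors, divisorDensity D n * a n * χ n).re := by
  have h := ha D.divisors χ fun m hm => (Nat.pos_of_mem_divisors hm).ne'
  have h1 : ∀ m ∈ D.divisors, (∑ l ∈ D.divisors, if l ∣ m then χ m * conj (χ l) * a (m / l) else 0)
      = ∑ n ∈ D.divisors, if n ∣ m then a n * χ n else 0 := by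
    intro m hm
    have hm' := Nat.mem_divisors.1 hm
    have hm0 : m ≠ 0 := (Nat.pos_of_mem_divisors hm).ne'
    have h2 : D.divisors.filter (· ∣ m) = m.divisors := by
      ext l
      simp only [Finset.mem_filter, Nat.mem_divisors]
      exact ⟨fun h => ⟨h.2, hm0⟩, fun h => ⟨⟨h.1.trans hm'.1, hD⟩, h.1⟩⟩
    rw [← Finset.sum_filter, ← Finset.sum_filter, h2,
      ← Nat.sum_div_divisors m fun n => a n * χ n]
    refine Finset.sum_congr rfl fun l hl => ?_
    obtain ⟨n, rfl⟩ := (Nat.mem_divisors.1 hl).1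
    have hl0 : l ≠ 0 := left_ne_zero_of_mul hm0
    rw [Nat.mul_div_cancel_left _ (Nat.pos_of_ne_zero hl0),
      hχ.map_mul l n hl0 (right_ne_zero_of_mul hm0)]
    have h3 := Complex.mul_conj' (χ l)
    rw [hχ.norm_eq_one l hl0] at h3
    push_cast at h3
    linear_combination (χ n * a n) * h3
  rw [Finset.sum_congr rfl h1, Finset.sum_comm] at h
  have h4 : ∑ n ∈ D.divisors, ∑ m ∈ D.divisors, (if n ∣ m then a n * χ n else 0)
      = (D.divisors.card : ℝ) * ∑ n ∈ D.divisors, divisorDensity D n * a n * χ n := by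
    rw [Finset.mul_sum]
    refine Finset.sum_congr rfl fun n hn => ?_
    rw [← Finset.sum_filter, Finset.sum_const, card_divisors_filter_dvd hD
      (Nat.mem_divisors.1 hn).1, divisorDensity]
    have : ((D.divisors.card : ℕ) : ℂ) ≠ 0 := by simpa using hD
    push_cast
    field_simp
    rw [nsmul_eq_mul]
    ring
  rw [h4, Complex.re_ofReal_mul] at h
  refine nonneg_of_mul_nonneg_right h ?_
  exact_mod_cast Finset.card_pos.2 ⟨1, by simpa using hD⟩

/-- Twisting `χ` by `exp (i t Ω(n))` turns the divisor sum into a trigonometric polynomial in `t`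
with frequencies `Ω(n) ≥ 0`, to which Carathéodory's bound applies. Its constant term comes from `n
= 1` only. -/
theorem IsMulToeplitzNonneg.norm_sum_divisors_le {a : ℕ → ℂ} (ha : IsMulToeplitzNonneg a)
    {χ : ℕ → ℂ} (hχ : IsUnimodularChar χ) {D : ℕ} (hD : D ≠ 0) {k : ℕ} (hk : k ≠ 0) :
    ‖∑ n ∈ D.divisors with cardFactors n = k, divisorDensity D n * a n * χ n‖
      ≤ 2 * (a 1).re := by
  have h := norm_sum_le_of_re_nonneg D.divisors (fun n => divisorDensity D n * a n * χ n)
    cardFactors (fun t => ?_) hk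
  · have h1 : D.divisors.filter (fun n => cardFactors n = 0) = {1} := by
      ext n
      simp only [Finset.mem_filter, Nat.mem_divisors, Finset.mem_singleton,
        cardFactors_eq_zero_iff_eq_zero_or_one]
      constructor
      · rintro ⟨⟨h1, _⟩, rfl | rfl⟩
        · exact absurd (zero_dvd_iff.1 h1) hD
        · rfl
      · rintro rfl
        simp [hD]
    rw [h1, Finset.sum_singleton, divisorDensity_one hD, hχ.map_one] at h
    simpa using h
  · have := ha.re_sum_divisors_nonneg (hχ.mul (isUnimodularChar_cardFactors t)) hD
    simpa only [mul_assoc] using this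

theorem divisorDensity_prime {D p : ℕ} (hD : D ≠ 0) (hp : p.Prime) (hpD : p ∣ D) :
    divisorDensity D p = 1 - 1 / ((D.factorization p : ℝ) + 1) := by
  obtain ⟨v, D', hpD', rfl⟩ := Nat.exists_eq_pow_mul_and_not_dvd hD p hp.ne_one
  have hD' : D' ≠ 0 := right_ne_zero_of_mul hD
  have hcop : ∀ k, (p ^ k).Coprime D' := fun k => ((Nat.Prime.coprime_iff_not_dvd hp).2 hpD').pow_left k
  have hcard : ∀ k, (p ^ k).divisors.card = k + 1 := fun k => by
    rw [Nat.divisors_prime_pow hp, Finset.card_map, Finset.card_range]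
  have hv : v ≠ 0 := by
    rintro rfl
    simp only [pow_zero, one_mul] at hpD
    exact hpD' hpD
  obtain ⟨w, rfl⟩ := Nat.exists_eq_succ_of_ne_zero hv
  have h1 : p ^ (w + 1) * D' / p = p ^ w * D' := by
    rw [pow_succ, mul_assoc, mul_left_comm, Nat.mul_div_cancel_left _ hp.pos]
  have h2 : (p ^ (w + 1) * D').factorization p = w + 1 := by
    rw [Nat.factorization_mul (pow_ne_zero _ hp.ne_zero) hD', Finsupp.add_apply,
      hp.factorization_pow, Finsupp.single_eq_same, Nat.factorization_eq_zero_of_not_dvd hpD']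
  have h3 : (D'.divisors.card : ℝ) ≠ 0 := by simpa using hD'
  have h4 : ((w : ℝ) + 1 + 1) ≠ 0 := by positivity
  rw [divisorDensity, Nat.succ_eq_add_one, h1, h2, (hcop _).card_divisors_mul,
    (hcop _).card_divisors_mul, hcard, hcard]
  push_cast
  field_simp
  ring

/-- The density of `p * a` in `D` is the density of `p` in `D` times that of `a` in `D / p`. The
sequence `D / p` is again eventually divisible by every `m`, hence the induction over all such
sequences; the density of `p` is `1 - 1 / (v + 1)`, where the exponent `v` of `p` in `D` tends to
infinity. -/
theorem tendsto_divisorDensity {n : ℕ} (hn : n ≠ 0) (D : ℕ → ℕ)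
    (hD : ∀ m, m ≠ 0 → ∀ᶠ N in atTop, m ∣ D N ∧ D N ≠ 0) :
    Tendsto (fun N => divisorDensity (D N) n) atTop (𝓝 1) := by
  induction n using induction_on_primes generalizing D with
  | zero => exact absurd rfl hn
  | one =>
    refine tendsto_const_nhds.congr' ?_
    filter_upwards [hD 1 one_ne_zero] with N hN
    exact (divisorDensity_one hN.2).symm
  | prime_mul p a hp ih =>
    have ha : a ≠ 0 := right_ne_zero_of_mul hn
    have h1 := ih ha (fun N => D N / p) fun m hm => by
      filter_upwards [hD (p * m) (mul_ne_zero hp.ne_zero hm)] with N hN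
      have h2 : m ∣ D N / p := Nat.dvd_div_of_mul_dvd hN.1
      exact ⟨h2, (Nat.div_pos (Nat.le_of_dvd (Nat.pos_of_ne_zero hN.2)
        ((dvd_mul_right p m).trans hN.1)) hp.pos).ne'⟩
    have h2 : Tendsto (fun N => (D N).factorization p) atTop atTop := by
      refine tendsto_atTop.2 fun j => ?_
      filter_upwards [hD (p ^ j) (pow_ne_zero _ hp.ne_zero)] with N hN
      exact (hp.pow_dvd_iff_le_factorization hN.2).1 hN.1
    have h3 : Tendsto (fun N => divisorDensity (D N) p) atTop (𝓝 1) := by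
      have := (tendsto_one_div_add_atTop_nhds_zero_nat (𝕜 := ℝ)).comp h2
      have h4 := this.const_sub 1
      rw [sub_zero] at h4
      refine h4.congr' ?_
      filter_upwards [hD p hp.ne_zero] with N hN
      exact (divisorDensity_prime hN.2 hp hN.1).symm
    have h5 := h3.mul h1
    rw [one_mul] at h5
    refine h5.congr' ?_
    filter_upwards [hD p hp.ne_zero] with N hN
    have h6 : D N / p ≠ 0 :=
      (Nat.div_pos (Nat.le_of_dvd (Nat.pos_of_ne_zero hN.2) hN.1) hp.pos).ne'
    have h7 : ((D N / p).divisors.card : ℝ) ≠ 0 := by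
      simpa using ⟨hp.ne_zero, Nat.le_of_dvd (Nat.pos_of_ne_zero hN.2) hN.1⟩
    simp only [divisorDensity, Nat.div_div_eq_div_mul] at h7 ⊢
    field_simp

theorem eventually_dvd_factorial {m : ℕ} (hm : m ≠ 0) :
    ∀ᶠ N : ℕ in atTop, m ∣ N.factorial ∧ N.factorial ≠ 0 := by
  filter_upwards [eventually_ge_atTop m] with N hN
  exact ⟨Nat.dvd_factorial (Nat.pos_of_ne_zero hm) hN, N.factorial_ne_zero⟩

theorem eventually_subset_divisors_factorial {Q : Finset ℕ} (hQ : ∀ n ∈ Q, n ≠ 0) :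
    ∀ᶠ N : ℕ in atTop, Q ⊆ N.factorial.divisors := by
  have : ∀ᶠ N : ℕ in atTop, ∀ n ∈ Q, n ∣ N.factorial ∧ N.factorial ≠ 0 :=
    (Finset.eventually_all Q).2 fun n hn => eventually_dvd_factorial (hQ n hn)
  filter_upwards [this] with N hN n hn
  exact Nat.mem_divisors.2 (hN n hn)

/-- A unimodular character takes arbitrary values on primes, so one can be chosen that makes every
`a p * χ p` equal to `‖a p‖`. The part with `Ω(n) = 1` is then a sum of norms, and the densities
tend to `1` along `N!`. -/
theorem IsMulToeplitzNonneg.sum_primes_norm_le {a : ℕ → ℂ} (ha : IsMulToeplitzNonneg a)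
    (Q : Finset ℕ) (hQ : ∀ p ∈ Q, p.Prime) : ∑ p ∈ Q, ‖a p‖ ≤ 2 * (a 1).re := by
  obtain ⟨χ, hχ, hχp⟩ := exists_isUnimodularChar
    (fun n => if a n = 0 then 1 else conj (a n) / ‖a n‖) fun n => by split_ifs with h <;> simp [h]
  have hmul : ∀ p, p.Prime → a p * χ p = (‖a p‖ : ℂ) := by
    intro p hp
    rw [hχp p hp]
    split_ifs with h
    · simp [h]
    · have h1 : (‖a p‖ : ℂ) ≠ 0 := by simpa using h
      have := Complex.mul_conj' (a p)
      field_simp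
      exact this
  have h1 : Tendsto (fun N : ℕ => ∑ p ∈ Q, divisorDensity N.factorial p * ‖a p‖) atTop
      (𝓝 (∑ p ∈ Q, 1 * ‖a p‖)) :=
    tendsto_finsetSum _ fun p hp => (tendsto_divisorDensity (hQ p hp).ne_zero _
      fun _ => eventually_dvd_factorial).mul_const _
  simp only [one_mul] at h1
  refine le_of_tendsto h1 ?_
  filter_upwards [eventually_subset_divisors_factorial fun p hp => (hQ p hp).ne_zero] with N hN
  have h2 := ha.norm_sum_divisors_le hχ N.factorial_ne_zero one_ne_zero
  have h3 : ∑ n ∈ N.factorial.divisors with cardFactors n = 1,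
      divisorDensity N.factorial n * a n * χ n
      = ((∑ n ∈ N.factorial.divisors with cardFactors n = 1,
        divisorDensity N.factorial n * ‖a n‖ : ℝ) : ℂ) := by
    push_cast
    refine Finset.sum_congr rfl fun p hp => ?_
    rw [mul_assoc, hmul p (cardFactors_eq_one_iff_prime.1 (Finset.mem_filter.1 hp).2)]
  rw [h3, Complex.norm_real] at h2
  refine le_trans ?_ ((le_abs_self _).trans h2)
  refine Finset.sum_le_sum_of_subset_of_nonneg (fun p hp => ?_)
    fun n _ _ => mul_nonneg (divisorDensity_nonneg _ _) (norm_nonneg _)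
  exact Finset.mem_filter.2 ⟨hN hp, cardFactors_eq_one_iff_prime.2 (hQ p hp)⟩

/-- The characters `n ^ (it)` make each homogeneous part a Dirichlet polynomial bounded by `2 * (a
1).re` on a vertical line, so Bessel's inequality applies. -/
theorem IsMulToeplitzNonneg.sum_sq_norm_le {a : ℕ → ℂ} (ha : IsMulToeplitzNonneg a)
    {k : ℕ} (hk : k ≠ 0) (Q : Finset ℕ) (hQ : ∀ n ∈ Q, cardFactors n = k) :
    ∑ n ∈ Q, ‖a n‖ ^ 2 ≤ (2 * (a 1).re) ^ 2 := by
  have hQ0 : ∀ n ∈ Q, n ≠ 0 := by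
    rintro n hn rfl
    exact hk (by simpa using (hQ 0 hn).symm)
  have h1 : Tendsto (fun N : ℕ => ∑ n ∈ Q, (divisorDensity N.factorial n * ‖a n‖) ^ 2) atTop
      (𝓝 (∑ n ∈ Q, (1 * ‖a n‖) ^ 2)) :=
    tendsto_finsetSum _ fun n hn => ((tendsto_divisorDensity (hQ0 n hn) _
      fun _ => eventually_dvd_factorial).mul_const _).pow 2
  simp only [one_mul] at h1
  refine le_of_tendsto h1 ?_
  filter_upwards [eventually_subset_divisors_factorial hQ0] with N hN
  have h2 := sum_sq_norm_le_of_norm_le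
    (N.factorial.divisors.filter fun n => cardFactors n = k)
    (fun n hn => (Nat.pos_of_mem_divisors (Finset.mem_filter.1 hn).1).ne')
    (fun n => divisorDensity N.factorial n * a n)
    fun t => ha.norm_sum_divisors_le (isUnimodularChar_log t) N.factorial_ne_zero hk
  refine le_trans ?_ h2
  simp only [norm_mul, Complex.norm_real, Real.norm_of_nonneg (divisorDensity_nonneg _ _)]
  refine Finset.sum_le_sum_of_subset_of_nonneg (fun p hp => ?_) fun n _ _ => by positivity
  exact Finset.mem_filter.2 ⟨hN hp, hQ p hp⟩

/-! ### Numerical estimates at the exponent 69/40 -/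

theorem rpow_neg_div_le {x u : ℝ} (hx : 0 < x) (hu : 0 ≤ u) (m n : ℕ) (hn : n ≠ 0)
    (h : 1 ≤ u ^ n * x ^ m) : x ^ (-(m / n : ℝ)) ≤ u := by
  rw [← pow_le_pow_iff_left₀ (by positivity) hu hn, ← Real.rpow_natCast, ← Real.rpow_mul hx.le]
  have hn' : (n : ℝ) ≠ 0 := by exact_mod_cast hn
  have : -(m / n : ℝ) * n = -(m : ℝ) := by field_simp
  rw [this, Real.rpow_neg hx.le, Real.rpow_natCast, inv_le_iff_one_le_mul₀ (by positivity)]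
  exact h

theorem rpow_two_le : (2 : ℝ) ^ (-(69 / 40 : ℝ)) ≤ 0.3026 := by
  simpa using rpow_neg_div_le (x := 2) (u := 0.3026) (by norm_num) (by norm_num) 69 40
    (by norm_num) (by norm_num)

/-- A majorant that telescopes over odd `x`: the factor `x ^ (-9/20)` is at most `1 / 2` from `5`
on, and `x ^ (-3) ≤ x / (x ^ 2 - 1) ^ 2`. -/
theorem rpow_tail_le {x : ℝ} (hx : 5 ≤ x) :
    x ^ (-(69 / 20 : ℝ)) ≤ (1 / 8) * (1 / (x - 1) ^ 2 - 1 / (x + 1) ^ 2) := by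
  have hx0 : 0 < x := by linarith
  have h1 : x ^ (-(9 / 20 : ℝ)) ≤ 1 / 2 := by
    have h5 : (5 : ℝ) ^ (-(9 / 20 : ℝ)) ≤ 1 / 2 := by
      simpa using rpow_neg_div_le (x := 5) (u := 1 / 2) (by norm_num) (by norm_num) 9 20
        (by norm_num) (by norm_num)
    exact (Real.rpow_le_rpow_of_nonpos (by norm_num) hx (by norm_num)).trans h5
  have h2 : x ^ (-(69 / 20 : ℝ)) = x ^ (-(9 / 20 : ℝ)) * (x ^ 3)⁻¹ := by
    rw [← Real.rpow_natCast x 3, ← Real.rpow_neg hx0.le, ← Real.rpow_add hx0]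
    norm_num
  have h3 : (1 / 8 : ℝ) * (1 / (x - 1) ^ 2 - 1 / (x + 1) ^ 2) = 1 / 2 * (x / (x ^ 2 - 1) ^ 2) := by
    have h4 : x - 1 ≠ 0 := by linarith
    have h5 : x + 1 ≠ 0 := by linarith
    have h6 : x ^ 2 - 1 ≠ 0 := by nlinarith
    have h7 : (x ^ 2 - 1) = (x - 1) * (x + 1) := by ring
    rw [h7]
    field_simp
    ring
  rw [h2, h3]
  refine mul_le_mul h1 ?_ (by positivity) (by norm_num)
  rw [inv_eq_one_div, div_le_div_iff₀ (by positivity) (by apply sq_pos_of_pos; nlinarith)]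
  nlinarith [sq_nonneg x]

theorem sum_primes_rpow_le (N : ℕ) :
    ∑ p ∈ Finset.range N with p.Prime, (p : ℝ) ^ (-(69 / 20 : ℝ)) ≤ 0.3493 ^ 2 := by
  -- The primes `2` and `3` are estimated by hand. Each further step adds an odd number, bounded by
  -- the telescoping majorant whether prime or not, and an even number that is not prime.
  have hodd : ∀ j : ℕ, ∑ p ∈ Finset.range (2 * (j + 2)) with p.Prime, (p : ℝ) ^ (-(69 / 20 : ℝ))
      ≤ 0.09155 + 0.0226 + (1 / 8) * (1 / 16 - 1 / (2 * j + 4) ^ 2) := by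
    intro j
    induction j with
    | zero =>
      have h2 : (2 : ℝ) ^ (-(69 / 20 : ℝ)) ≤ 0.09155 := by
        simpa using rpow_neg_div_le (x := 2) (u := 0.09155) (by norm_num) (by norm_num) 69 20
          (by norm_num) (by norm_num)
      have h3 : (3 : ℝ) ^ (-(69 / 20 : ℝ)) ≤ 0.0226 := by
        simpa using rpow_neg_div_le (x := 3) (u := 0.0226) (by norm_num) (by norm_num) 69 20
          (by norm_num) (by norm_num)
      have : (Finset.range (2 * (0 + 2))).filter Nat.Prime = {2, 3} := by decide
      rw [this, Finset.sum_pair (by norm_num)]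
      push_cast
      norm_num at h2 h3 ⊢
      linarith
    | succ j ih =>
      have he : ¬ (2 * (j + 2)).Prime := Nat.not_prime_mul (by norm_num) (by omega)
      have h1 : 2 * (j + 1 + 2) = 2 * (j + 2) + 1 + 1 := by ring
      rw [Finset.sum_filter] at ih ⊢
      rw [h1, Finset.sum_range_succ, Finset.sum_range_succ, if_neg he, add_zero]
      have h2 : (if (2 * (j + 2) + 1).Prime then
          ((2 * (j + 2) + 1 : ℕ) : ℝ) ^ (-(69 / 20 : ℝ)) else 0)
          ≤ (1 / 8) * (1 / (2 * j + 4) ^ 2 - 1 / (2 * (j + 1 : ℕ) + 4) ^ 2) := by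
        have h3 := rpow_tail_le (x := ((2 * (j + 2) + 1 : ℕ) : ℝ)) (by
          push_cast; have : (0 : ℝ) ≤ j := j.cast_nonneg
          linarith)
        have h4 : (((2 * (j + 2) + 1 : ℕ) : ℝ) - 1) = 2 * j + 4 := by push_cast; ring
        have h5 : (((2 * (j + 2) + 1 : ℕ) : ℝ) + 1) = 2 * (j + 1 : ℕ) + 4 := by push_cast; ring
        rw [h4, h5] at h3
        split_ifs
        · exact h3
        · refine le_trans ?_ h3
          positivity
      linarith
  refine le_trans ?_ ((hodd N).trans ?_)
  · refine Finset.sum_le_sum_of_subset_of_nonneg (Finset.filter_subset_filter _ ?_)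
      fun _ _ _ => by positivity
    exact Finset.range_subset_range.2 (by omega)
  · have : 0 ≤ 1 / (2 * (N : ℝ) + 4) ^ 2 := by positivity
    generalize 1 / (2 * (N : ℝ) + 4) ^ 2 = y at this ⊢
    norm_num
    linarith

/-- Splitting off the least prime factor embeds the integers with `Ω(n) = k + 1` into pairs of an
integer with `Ω = k` and a prime, and the summand is multiplicative. -/
theorem sum_cardFactors_rpow_le (N k : ℕ) :
    ∑ n ∈ Finset.range N with cardFactors n = k, (n : ℝ) ^ (-(69 / 20 : ℝ))
      ≤ (0.3493 ^ 2) ^ k := by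
  induction k with
  | zero =>
    have h1 : (Finset.range N).filter (fun n => cardFactors n = 0) ⊆ {0, 1} := by
      intro n hn
      simpa using cardFactors_eq_zero_iff_eq_zero_or_one.1 (Finset.mem_filter.1 hn).2
    refine (Finset.sum_le_sum_of_subset_of_nonneg h1 fun _ _ _ => by positivity).trans ?_
    rw [Finset.sum_pair zero_ne_one, Nat.cast_zero, Real.zero_rpow (by norm_num)]
    simp
  | succ k ih =>
    have hmin : ∀ n, cardFactors n = k + 1 → n ≠ 0 ∧ n.minFac.Prime ∧ n.minFac * (n / n.minFac) = n
        ∧ cardFactors (n / n.minFac) = k := by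
      intro n hn
      have h1 : 1 < n := cardFactors_pos_iff_one_lt.1 (by omega)
      have hp := Nat.minFac_prime h1.ne'
      have h2 := Nat.mul_div_cancel' n.minFac_dvd
      have h3 : n / n.minFac ≠ 0 := by
        intro h
        rw [h, mul_zero] at h2
        omega
      refine ⟨by omega, hp, h2, ?_⟩
      rw [← h2, cardFactors_mul hp.ne_zero h3, cardFactors_apply_prime hp] at hn
      omega
    rw [pow_succ]
    refine le_trans ?_ (mul_le_mul ih (sum_primes_rpow_le N)
      (Finset.sum_nonneg fun _ _ => by positivity) (by positivity))
    rw [Finset.sum_mul_sum, ← Finset.sum_product']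
    have hinj : Set.InjOn (fun n : ℕ => (n / n.minFac, n.minFac))
        ((Finset.range N).filter fun n => cardFactors n = k + 1) := by
      intro m hm n hn h
      simp only [Prod.mk.injEq] at h
      rw [← (hmin m (Finset.mem_filter.1 hm).2).2.2.1, ← (hmin n (Finset.mem_filter.1 hn).2).2.2.1,
        h.1, h.2]
    calc _ = ∑ n ∈ Finset.range N with cardFactors n = k + 1,
          ((n / n.minFac : ℕ) : ℝ) ^ (-(69 / 20 : ℝ)) * (n.minFac : ℝ) ^ (-(69 / 20 : ℝ)) := by
            refine Finset.sum_congr rfl fun n hn => ?_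
            rw [← Real.mul_rpow (by positivity) (by positivity), ← Nat.cast_mul, mul_comm,
              (hmin n (Finset.mem_filter.1 hn).2).2.2.1]
      _ = ∑ x ∈ ((Finset.range N).filter fun n => cardFactors n = k + 1).image
            fun n : ℕ => (n / n.minFac, n.minFac),
          (x.1 : ℝ) ^ (-(69 / 20 : ℝ)) * (x.2 : ℝ) ^ (-(69 / 20 : ℝ)) := by
            rw [Finset.sum_image hinj]
      _ ≤ _ := by
            refine Finset.sum_le_sum_of_subset_of_nonneg ?_ fun _ _ _ => by positivity
            intro x hx
            obtain ⟨n, hn, rfl⟩ := Finset.mem_image.1 hx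
            obtain ⟨hnN, hnk⟩ := Finset.mem_filter.1 hn
            obtain ⟨h0, hp, h2, h3⟩ := hmin n hnk
            have hnN := Finset.mem_range.1 hnN
            simp only [Finset.mem_product, Finset.mem_filter, Finset.mem_range]
            exact ⟨⟨(Nat.div_le_self _ _).trans_lt hnN, h3⟩,
              ((Nat.minFac_le (Nat.pos_of_ne_zero h0)).trans_lt hnN), hp⟩

theorem IsMulToeplitzNonneg.sum_norm_rpow_le {a : ℕ → ℂ} (ha : IsMulToeplitzNonneg a) (N : ℕ) :
    ∑ n ∈ Finset.range N with 1 < n, ‖a n‖ * (n : ℝ) ^ (-(69 / 40 : ℝ)) ≤ 0.99 * (a 1).re := by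
  have hR : 0 ≤ (a 1).re := by
    have := ha.sum_primes_norm_le ∅ (by simp)
    simpa using this
  -- Both `0` and `1` have `cardFactors` equal to `0`; the condition `1 < n` removes them, so `S 0`
  -- vanishes.
  let S : ℕ → ℝ := fun k => ∑ n ∈ Finset.range N with cardFactors n = k,
    if 1 < n then ‖a n‖ * (n : ℝ) ^ (-(69 / 40 : ℝ)) else 0
  have hS0 : S 0 ≤ 0 := by
    refine Finset.sum_nonpos fun n hn => ?_
    rw [if_neg]
    rcases cardFactors_eq_zero_iff_eq_zero_or_one.1 (Finset.mem_filter.1 hn).2 with rfl | rfl <;>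
      norm_num
  -- The `ℓ¹` bound over primes costs only the largest weight, the one at `p = 2`.
  have hS1 : S 1 ≤ 0.3026 * (2 * (a 1).re) := by
    have h1 := ha.sum_primes_norm_le ((Finset.range N).filter fun n => cardFactors n = 1)
      fun p hp => cardFactors_eq_one_iff_prime.1 (Finset.mem_filter.1 hp).2
    refine le_trans ?_ (mul_le_mul_of_nonneg_left h1 (by norm_num))
    rw [Finset.mul_sum]
    refine Finset.sum_le_sum fun p hp => ?_
    have hp2 := (cardFactors_eq_one_iff_prime.1 (Finset.mem_filter.1 hp).2).two_le
    rw [if_pos (by omega), mul_comm]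
    refine mul_le_mul_of_nonneg_right (le_trans ?_ rpow_two_le) (norm_nonneg _)
    exact Real.rpow_le_rpow_of_nonpos (by norm_num) (by exact_mod_cast hp2) (by norm_num)
  have hS : ∀ k, S (k + 2) ≤ 2 * (a 1).re * 0.3493 ^ (k + 2) := by
    intro k
    refine abs_le_of_sq_le_sq' ?_ (by positivity) |>.2
    have h1 := ha.sum_sq_norm_le (k := k + 2) (by omega)
      ((Finset.range N).filter fun n => cardFactors n = k + 2)
      fun n hn => (Finset.mem_filter.1 hn).2
    have h2 := sum_cardFactors_rpow_le N (k + 2)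
    have h3 : S (k + 2) = ∑ n ∈ Finset.range N with cardFactors n = k + 2,
        ‖a n‖ * (n : ℝ) ^ (-(69 / 40 : ℝ)) := by
      refine Finset.sum_congr rfl fun n hn => if_pos ?_
      have := (Finset.mem_filter.1 hn).2
      exact cardFactors_pos_iff_one_lt.1 (by omega)
    rw [h3]
    refine (Finset.sum_mul_sq_le_sq_mul_sq _ _ _).trans ?_
    rw [mul_pow, ← pow_mul, mul_comm (k + 2) 2, pow_mul]
    refine mul_le_mul h1 (le_trans (le_of_eq ?_) h2) (Finset.sum_nonneg fun _ _ => by positivity)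
      (by positivity)
    refine Finset.sum_congr rfl fun n _ => ?_
    rw [← Real.rpow_natCast, ← Real.rpow_mul n.cast_nonneg]
    norm_num
  obtain ⟨K, hK⟩ : ∃ K, ∀ n ∈ Finset.range N, cardFactors n ∈ Finset.range (K + 2) :=
    ⟨(Finset.range N).sup cardFactors, fun n hn =>
      Finset.mem_range.2 (by have := Finset.le_sup (f := cardFactors) hn; omega)⟩
  have htot : ∑ n ∈ Finset.range N with 1 < n, ‖a n‖ * (n : ℝ) ^ (-(69 / 40 : ℝ))
      = ∑ k ∈ Finset.range (K + 2), S k := by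
    rw [Finset.sum_filter, ← Finset.sum_fiberwise_of_maps_to hK]
  have hgeom : ∑ k ∈ Finset.range K, (0.3493 : ℝ) ^ (k + 2) ≤ 0.18752 := by
    simp_rw [pow_add]
    rw [← Finset.sum_mul]
    have h1 : ∑ k ∈ Finset.range K, (0.3493 : ℝ) ^ k ≤ (1 - 0.3493)⁻¹ := by
      rw [← tsum_geometric_of_lt_one (by norm_num) (by norm_num)]
      exact (summable_geometric_of_lt_one (by norm_num) (by norm_num)).sum_le_tsum _
        fun _ _ => by positivity
    calc _ ≤ (1 - 0.3493 : ℝ)⁻¹ * 0.3493 ^ 2 := by gcongr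
      _ ≤ _ := by norm_num
  rw [htot, Finset.sum_range_succ', Finset.sum_range_succ']
  have h1 : ∑ k ∈ Finset.range K, S (k + 1 + 1) ≤ 2 * (a 1).re * 0.18752 := by
    refine (Finset.sum_le_sum fun k _ => hS k).trans ?_
    rw [← Finset.mul_sum]
    gcongr
  have h2 : S (0 + 1) ≤ 0.3026 * (2 * (a 1).re) := hS1
  linarith

/-! ### Means on vertical lines and positivity of the Toeplitz form -/

/-- The means of an absolutely convergent Dirichlet series against `(m / l) ^ s` on a line inside
its half-plane of absolute convergence. -/
theorem tendsto_mean_LSeries_mul_exp {a : ℕ → ℂ} {c : ℝ} (hc : LSeriesSummable a c)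
    {m l : ℕ} (hm : m ≠ 0) (hl : l ≠ 0) :
    Tendsto (fun T : ℝ => (T : ℂ)⁻¹ * ∫ t in (0 : ℝ)..T, LSeries a (c + t * Complex.I) *
      Complex.exp ((c + t * Complex.I) * (Real.log m - Real.log l : ℝ))) atTop
      (𝓝 (if l ∣ m then a (m / l) else 0)) := by
  set θ : ℝ := Real.log m - Real.log l with hθ
  let B : ℕ → ℂ := fun n => LSeries.term a c n * Complex.exp (c * θ)
  let e : ℕ → ℝ := fun n => θ - Real.log n
  have hterm : ∀ (t : ℝ) n, LSeries.term a (c + t * Complex.I) n *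
      Complex.exp ((c + t * Complex.I) * θ) = B n * Complex.exp (e n * t * Complex.I) := by
    intro t n
    rcases eq_or_ne n 0 with rfl | hn
    · simp [B]
    · have hn' : (n : ℂ) ≠ 0 := by exact_mod_cast hn
      simp only [B, e, LSeries.term_of_ne_zero hn, Complex.cpow_def_of_ne_zero hn',
        ← Complex.natCast_log, div_eq_mul_inv, ← Complex.exp_neg]
      rw [mul_assoc, ← Complex.exp_add, mul_assoc, mul_assoc, ← Complex.exp_add, ← Complex.exp_add]
      push_cast
      ring_nf
  have hB : Summable fun n => ‖B n‖ := by
    simpa only [B, norm_mul] using (hc.norm).mul_right _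
  have hnorm : ∀ n (t : ℝ), ‖B n * Complex.exp (e n * t * Complex.I)‖ = ‖B n‖ := by
    intro n t
    rw [norm_mul, ← Complex.ofReal_mul, Complex.norm_exp_ofReal_mul_I, mul_one]
  have hlim : ∀ n, (if e n = 0 then B n else 0) = if n * l = m then a n else 0 := by
    intro n
    rcases eq_or_ne n 0 with rfl | hn
    · simp [B, hm.symm]
    · have hn0 : (0 : ℝ) < n := by exact_mod_cast Nat.pos_of_ne_zero hn
      have hl0 : (0 : ℝ) < l := by exact_mod_cast Nat.pos_of_ne_zero hl
      have hm0 : (0 : ℝ) < m := by exact_mod_cast Nat.pos_of_ne_zero hm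
      have h1 : e n = 0 ↔ n * l = m := by
        have : e n = Real.log m - Real.log (n * l) := by
          simp only [e, hθ]; rw [Real.log_mul hn0.ne' hl0.ne']; ring
        rw [this, sub_eq_zero]
        constructor
        · intro h
          have := Real.log_injOn_pos hm0 (mul_pos hn0 hl0) h
          exact_mod_cast this.symm
        · rintro rfl
          push_cast
          rfl
      simp only [← h1]
      split_ifs with h
      · have h2 : θ = Real.log n := sub_eq_zero.1 h
        have hn' : (n : ℂ) ≠ 0 := by exact_mod_cast hn
        simp only [B, LSeries.term_of_ne_zero hn, h2, Complex.cpow_def_of_ne_zero hn',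
          ← Complex.natCast_log]
        rw [mul_comm (c : ℂ), div_mul_cancel₀ _ (Complex.exp_ne_zero _)]
      · rfl
  have hsum : (∑' n, if e n = 0 then B n else 0) = if l ∣ m then a (m / l) else 0 := by
    simp_rw [hlim]
    -- The truncated quotient serves as the single index even when `l ∤ m`: its term then vanishes
    -- because `(m / l) * l ≠ m`.
    rw [tsum_eq_single (m / l)]
    · by_cases h : l ∣ m
      · rw [if_pos h, if_pos (Nat.div_mul_cancel h)]
      · rw [if_neg h, if_neg]
        rintro h'
        exact h ⟨m / l, by rw [mul_comm]; exact h'.symm⟩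
    · intro n hn
      refine if_neg ?_
      rintro rfl
      exact hn (Nat.mul_div_cancel _ (Nat.pos_of_ne_zero hl)).symm
  have hint : ∀ T : ℝ, 0 < T → (T : ℂ)⁻¹ * ∫ t in (0 : ℝ)..T, LSeries a (c + t * Complex.I) *
      Complex.exp ((c + t * Complex.I) * θ)
      = ∑' n, B n * ((T : ℂ)⁻¹ * ∫ t in (0 : ℝ)..T, Complex.exp (e n * t * Complex.I)) := by
    intro T hT
    have h1 := intervalIntegral.hasSum_intervalIntegral_of_summable_norm (ι := ℕ) (a := 0) (b := T)
      (f := fun n => ⟨fun t : ℝ => B n * Complex.exp (e n * t * Complex.I), by fun_prop⟩) ?_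
    · simp only [ContinuousMap.coe_mk] at h1
      have h2 := h1.mul_left (T : ℂ)⁻¹
      simp only [LSeries, ← tsum_mul_right, hterm]
      rw [← h2.tsum_eq]
      refine tsum_congr fun n => ?_
      rw [intervalIntegral.integral_const_mul]
      ring
    · refine Summable.of_nonneg_of_le (fun _ => norm_nonneg _) (fun n => ?_) hB
      rw [ContinuousMap.norm_le _ (norm_nonneg _)]
      rintro ⟨t, ht⟩
      exact (hnorm n t).le
  rw [← hsum]
  have hmean : ∀ (T : ℝ) n, 0 < T →
      ‖(T : ℂ)⁻¹ * ∫ t in (0 : ℝ)..T, Complex.exp (e n * t * Complex.I)‖ ≤ 1 := by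
    intro T n hT
    have := intervalIntegral.norm_integral_le_of_norm_le_const (a := 0) (b := T) (C := 1)
      (f := fun t : ℝ => Complex.exp (e n * t * Complex.I)) fun t _ => by
        rw [← Complex.ofReal_mul, Complex.norm_exp_ofReal_mul_I]
    rw [norm_mul, norm_inv, Complex.norm_real, Real.norm_of_nonneg hT.le,
      inv_mul_le_iff₀ hT, mul_one]
    rwa [sub_zero, abs_of_pos hT, one_mul] at this
  have key : Tendsto (fun T : ℝ => ∑' n, B n * ((T : ℂ)⁻¹ *
      ∫ t in (0 : ℝ)..T, Complex.exp (e n * t * Complex.I))) atTop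
      (𝓝 (∑' n, if e n = 0 then B n else 0)) := by
    refine tendsto_tsum_of_dominated_convergence hB (fun n => ?_) ?_
    · have := (tendsto_mean_exp (e n)).const_mul (B n)
      simpa only [mul_ite, mul_one, mul_zero] using this
    · filter_upwards [eventually_gt_atTop 0] with T hT n
      rw [norm_mul]
      exact mul_le_of_le_one_right (norm_nonneg _) (hmean T n hT)
  refine key.congr' ?_
  filter_upwards [eventually_gt_atTop 0] with T hT
  exact (hint T hT).symm

/-- The means of a function holomorphic and bounded in a strip do not depend on the line. -/
theorem tendsto_mean_sub_mean {g : ℂ → ℂ} {x y C : ℝ} (hxy : x ≤ y)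
    (hg : ∀ s : ℂ, x ≤ s.re → s.re ≤ y → DifferentiableAt ℂ g s)
    (hC : ∀ s : ℂ, x ≤ s.re → s.re ≤ y → ‖g s‖ ≤ C) :
    Tendsto (fun T : ℝ => (T : ℂ)⁻¹ * (∫ t in (0 : ℝ)..T, g (x + t * Complex.I)) -
      (T : ℂ)⁻¹ * ∫ t in (0 : ℝ)..T, g (y + t * Complex.I)) atTop (𝓝 0) := by
  have hb : ∀ T : ℝ, ‖∫ u in x..y, g (u + T * Complex.I)‖ ≤ C * (y - x) := by
    intro T
    have := intervalIntegral.norm_integral_le_of_norm_le_const (a := x) (b := y) (C := C)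
      (f := fun u : ℝ => g (u + T * Complex.I)) fun u hu => by
        rw [Set.uIoc_of_le hxy] at hu
        exact hC _ (by simpa using hu.1.le) (by simpa using hu.2)
    rwa [abs_of_nonneg (sub_nonneg.2 hxy)] at this
  rw [tendsto_zero_iff_norm_tendsto_zero]
  have h0 : Tendsto (fun T : ℝ => T⁻¹ * (2 * (C * (y - x)))) atTop (𝓝 0) := by
    simpa using tendsto_inv_atTop_zero.mul_const (2 * (C * (y - x)))
  refine squeeze_zero' (Eventually.of_forall fun _ => norm_nonneg _) ?_ h0
  filter_upwards [eventually_gt_atTop 0] with T hT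
  -- By Cauchy's theorem the two vertical integrals differ by the horizontal ones, which stay
  -- bounded as `T` grows and disappear after division by `T`.
  have h1 := Complex.integral_boundary_rect_eq_zero_of_differentiableOn g x (y + T * Complex.I) ?_
  · simp at h1
    have h2 : (∫ t in (0 : ℝ)..T, g (x + t * Complex.I)) - ∫ t in (0 : ℝ)..T, g (y + t * Complex.I)
        = -Complex.I * ((∫ u in x..y, g u) - ∫ u in x..y, g (u + T * Complex.I)) := by
      have := Complex.I_mul_I
      linear_combination Complex.I * h1 + ((∫ t in (0 : ℝ)..T, g (x + t * Complex.I)) -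
        ∫ t in (0 : ℝ)..T, g (y + t * Complex.I)) * this
    rw [← mul_sub, h2, norm_mul, norm_inv, Complex.norm_real, Real.norm_of_nonneg hT.le, norm_mul,
      norm_neg, Complex.norm_I, one_mul]
    gcongr
    have h3 := hb 0
    have h4 := hb T
    simp only [Complex.ofReal_zero, zero_mul, add_zero] at h3
    linarith [norm_sub_le (∫ u in x..y, g u) (∫ u in x..y, g (u + T * Complex.I))]
  · intro s hs
    simp [Complex.mem_reProdIm, Set.uIcc_of_le hxy] at hs
    exact (hg s hs.1.1 hs.1.2).differentiableWithinAt

/-- On the line `Re s = ε` the mean of `f * |∑ z m * m ^ (it)| ^ 2` has nonnegative real part. The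
means of `f(s) * (m / l) ^ s` that compose it are moved to `Re s = c`, where absolute convergence
evaluates them as coefficients. This gives the form with weights `(m / l) ^ (-ε)`, and `ε → 0`
removes the weights. Boundedness is needed only on each `Re s ≥ ε`, which covers both classes of
series. -/
theorem isMulToeplitzNonneg_of_re_nonneg {f : ℂ → ℂ} {a : ℕ → ℂ} {c : ℝ}
    (hf : DifferentiableOn ℂ f rightHalfPlane)
    (hb : ∀ ε : ℝ, 0 < ε → ∃ C, ∀ s : ℂ, ε ≤ s.re → ‖f s‖ ≤ C)
    (hre : ∀ s ∈ rightHalfPlane, 0 ≤ (f s).re) (hc : 0 < c) (hs : LSeriesSummable a c)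
    (hL : ∀ t : ℝ, f (c + t * Complex.I) = LSeries a (c + t * Complex.I)) :
    IsMulToeplitzNonneg a := by
  intro S z hS
  let θ : ℕ → ℕ → ℝ := fun m l => Real.log m - Real.log l
  let β : ℕ → ℕ → ℂ := fun m l => if l ∣ m then a (m / l) else 0
  have hopen : IsOpen rightHalfPlane := isOpen_lt continuous_const Complex.continuous_re
  have hdiff : ∀ s : ℂ, 0 < s.re → DifferentiableAt ℂ f s := fun s hs =>
    hf.differentiableAt (hopen.mem_nhds hs)
  have hcont : ∀ ε : ℝ, 0 < ε → Continuous fun t : ℝ => f (ε + t * Complex.I) := by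
    intro ε hε
    refine continuous_iff_continuousAt.2 fun t => ?_
    exact ContinuousAt.comp (f := fun t : ℝ => (ε + t * Complex.I : ℂ)) (g := f)
      (hdiff _ (by simpa using hε)).continuousAt (by fun_prop)
  have hline : ∀ ε : ℝ, 0 < ε → ε < c → ∀ m ∈ S, ∀ l ∈ S,
      Tendsto (fun T : ℝ => (T : ℂ)⁻¹ * ∫ t in (0 : ℝ)..T, f (ε + t * Complex.I) *
        Complex.exp ((ε + t * Complex.I) * θ m l)) atTop (𝓝 (β m l)) := by
    intro ε hε hεc m hm l hl
    obtain ⟨C, hC⟩ := hb ε hε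
    have h1 := tendsto_mean_LSeries_mul_exp hs (hS m hm) (hS l hl)
    have h2 := tendsto_mean_sub_mean (g := fun s => f s * Complex.exp (s * θ m l)) (x := ε) (y := c)
      (C := C * Real.exp (c * |θ m l|)) hεc.le ?_ ?_
    · have h3 := h2.add h1
      simp only [← hL, zero_add] at h3
      refine h3.congr fun T => ?_
      simp only [θ]
      ring
    · intro s h1 _
      have := hdiff s (hε.trans_le h1)
      fun_prop
    · intro s h1 h2
      rw [norm_mul, Complex.norm_exp]
      refine mul_le_mul (hC s h1) (Real.exp_le_exp.2 ?_) (Real.exp_pos _).le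
        ((norm_nonneg _).trans (hC s h1))
      rw [Complex.re_mul_ofReal]
      have h0 : 0 ≤ s.re := hε.le.trans h1
      calc s.re * θ m l ≤ s.re * |θ m l| := by gcongr; exact le_abs_self _
        _ ≤ _ := by gcongr
  have hε : ∀ ε : ℝ, 0 < ε → ε < c →
      0 ≤ (∑ m ∈ S, ∑ l ∈ S, z m * conj (z l) * Complex.exp (-(ε * θ m l)) * β m l).re := by
    intro ε hε hεc
    have hsq : ∀ t : ℝ, ∑ m ∈ S, ∑ l ∈ S, z m * conj (z l) * Complex.exp (-(ε * θ m l)) *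
        (f (ε + t * Complex.I) * Complex.exp ((ε + t * Complex.I) * θ m l))
        = f (ε + t * Complex.I) *
          ((‖∑ m ∈ S, z m * Complex.exp (Real.log m * t * Complex.I)‖ ^ 2 : ℝ) : ℂ) := by
      intro t
      rw [Complex.ofReal_pow, ← Complex.mul_conj', map_sum, Finset.sum_mul_sum, Finset.mul_sum]
      refine Finset.sum_congr rfl fun m _ => ?_
      rw [Finset.mul_sum]
      refine Finset.sum_congr rfl fun l _ => ?_
      have h1 : Complex.exp ((ε + t * Complex.I) * θ m l) = Complex.exp (ε * θ m l) *
          (Complex.exp (Real.log m * t * Complex.I) *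
            Complex.exp (Real.log l * t * -Complex.I)) := by
        rw [← Complex.exp_add, ← Complex.exp_add]
        simp only [θ]
        push_cast
        ring_nf
      have h2 : Complex.exp (-(ε * θ m l)) * Complex.exp (ε * θ m l) = 1 := by
        rw [← Complex.exp_add, neg_add_cancel, Complex.exp_zero]
      simp only [h1, map_mul, ← Complex.exp_conj, Complex.conj_ofReal, Complex.conj_I]
      linear_combination (z m * conj (z l) * f (ε + t * Complex.I) *
        Complex.exp (Real.log m * t * Complex.I) *
            Complex.exp (Real.log l * t * -Complex.I)) * h2
    have hcg : ∀ m l, Continuous fun t : ℝ => z m * conj (z l) * Complex.exp (-(ε * θ m l)) *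
        (f (ε + t * Complex.I) * Complex.exp ((ε + t * Complex.I) * θ m l)) := fun m l =>
      ((hcont ε hε).mul (by fun_prop)).const_mul _
    refine re_nonneg_of_tendsto_mean (g := fun t : ℝ =>
      ∑ m ∈ S, ∑ l ∈ S, z m * conj (z l) * Complex.exp (-(ε * θ m l)) *
        (f (ε + t * Complex.I) * Complex.exp ((ε + t * Complex.I) * θ m l))) ?_ ?_ ?_
    · exact continuous_finsetSum _ fun m _ => continuous_finsetSum _ fun l _ => hcg m l
    · intro t
      rw [hsq, Complex.re_mul_ofReal]
      exact mul_nonneg (hre _ (by simpa [rightHalfPlane] using hε)) (by positivity)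
    · have h1 : ∀ T : ℝ, (T : ℂ)⁻¹ * ∫ t in (0 : ℝ)..T,
          ∑ m ∈ S, ∑ l ∈ S, z m * conj (z l) * Complex.exp (-(ε * θ m l)) *
            (f (ε + t * Complex.I) * Complex.exp ((ε + t * Complex.I) * θ m l))
          = ∑ m ∈ S, ∑ l ∈ S, z m * conj (z l) * Complex.exp (-(ε * θ m l)) *
            ((T : ℂ)⁻¹ * ∫ t in (0 : ℝ)..T,
              f (ε + t * Complex.I) * Complex.exp ((ε + t * Complex.I) * θ m l)) := by
        intro T
        rw [intervalIntegral.integral_finsetSum, Finset.mul_sum]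
        · refine Finset.sum_congr rfl fun m _ => ?_
          rw [intervalIntegral.integral_finsetSum, Finset.mul_sum]
          · refine Finset.sum_congr rfl fun l _ => ?_
            rw [intervalIntegral.integral_const_mul]
            ring
          · exact fun l _ => (hcg m l).intervalIntegrable _ _
        · exact fun m _ => (continuous_finsetSum _ fun l _ => hcg m l).intervalIntegrable _ _
      simp_rw [h1]
      exact tendsto_finsetSum _ fun m hm => tendsto_finsetSum _ fun l hl =>
        (hline ε hε hεc m hm l hl).const_mul _
  have hlim : Tendsto (fun ε : ℝ =>
      (∑ m ∈ S, ∑ l ∈ S, z m * conj (z l) * Complex.exp (-(ε * θ m l)) * β m l).re) (𝓝[>] 0)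
      (𝓝 (∑ m ∈ S, ∑ l ∈ S, z m * conj (z l) * Complex.exp (-((0 : ℝ) * θ m l)) * β m l).re) := by
    refine Tendsto.mono_left (Continuous.tendsto ?_ 0) nhdsWithin_le_nhds
    fun_prop
  have hfin := ge_of_tendsto hlim (by
    filter_upwards [Ioo_mem_nhdsGT hc] with ε h
    exact hε ε h.1 h.2)
  simpa [β] using hfin

/-! ### The Bohr inequality for a domain -/

theorem HasDirichletSeries.eq_LSeries {f : ℂ → ℂ} {a : ℕ → ℂ} (h : HasDirichletSeries f a) {s : ℂ}
    (hs : s ∈ rightHalfPlane) (ha : LSeriesSummable a s) : f s = LSeries a s := by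
  refine tendsto_nhds_unique (h s hs) ?_
  have h1 := ((summable_nat_add_iff 1).2 ha).hasSum.tendsto_sum_nat
  have h2 : LSeries a s = ∑' n, LSeries.term a s (n + 1) := by
    rw [LSeries, ha.tsum_eq_zero_add, LSeries.term_zero, zero_add]
  rw [h2]
  refine h1.congr fun N => ?_
  rw [Finset.range_eq_Ico, Finset.sum_Ico_add' (fun n => LSeries.term a s n) 0 N 1]
  refine Finset.sum_congr (by ext n; simp) fun n hn => ?_
  exact LSeries.term_of_ne_zero (by have := Finset.mem_Icc.1 hn; omega) _ _

/-- Convergence at `s = 1` forces `a n / n → 0`, hence `a n = O(n)`. -/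
theorem HasDirichletSeries.lseriesSummable {f : ℂ → ℂ} {a : ℕ → ℂ} (h : HasDirichletSeries f a)
    {s : ℂ} (hs : 2 < s.re) : LSeriesSummable a s := by
  have h1 := h 1 (by simp [rightHalfPlane])
  have h2 : Tendsto (fun N : ℕ => a (N + 1) / ((N + 1 : ℕ) : ℂ)) atTop (𝓝 0) := by
    have := (h1.comp (tendsto_add_atTop_nat 1)).sub h1
    rw [sub_self] at this
    refine this.congr fun N => ?_
    simp only [Function.comp]
    rw [Finset.sum_Icc_succ_top (by omega), add_sub_cancel_left, Complex.cpow_one]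
  obtain ⟨C, hC⟩ := h2.norm.bddAbove_range
  refine LSeriesSummable_of_le_const_mul_rpow hs ⟨C, fun n hn => ?_⟩
  obtain ⟨m, rfl⟩ := Nat.exists_eq_succ_of_ne_zero hn
  have h3 := hC ⟨m, rfl⟩
  have hpos : (0 : ℝ) < ((m + 1 : ℕ) : ℝ) := by positivity
  dsimp only at h3
  rw [norm_div, Complex.norm_natCast, div_le_iff₀ hpos] at h3
  norm_num at h3 ⊢
  exact h3

theorem ConvergesAbsolutely.lseriesSummable {a : ℕ → ℂ} (h : ConvergesAbsolutely a) {s : ℂ}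
    (hs : s ∈ rightHalfPlane) : LSeriesSummable a s := by
  rw [LSeriesSummable, ← summable_nat_add_iff 1]
  refine Summable.of_norm ((h s hs).congr fun n => ?_)
  rw [LSeries.term_of_ne_zero n.succ_ne_zero]

theorem exists_re_mul_eq (φ : StrongDual ℝ ℂ) : ∃ u : ℂ, ∀ w, φ w = (u * w).re := by
  refine ⟨φ 1 - Complex.I * φ Complex.I, fun w => ?_⟩
  have h : w = w.re • (1 : ℂ) + w.im • Complex.I := by
    simp [Complex.re_add_im]
  conv_lhs => rw [h]
  rw [map_add, map_smul, map_smul]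
  simp
  ring

theorem bohrInequality_of_mapsTo {G : Set ℂ} (hG : IsOpen G)
    (hfr : (frontier (convexHull ℝ G)).Nonempty) {f : ℂ → ℂ} {a : ℕ → ℂ}
    (hser : HasDirichletSeries f a) (hf : DifferentiableOn ℂ f rightHalfPlane)
    (hb : ∀ ε : ℝ, 0 < ε → ∃ C, ∀ s : ℂ, ε ≤ s.re → ‖f s‖ ≤ C)
    (hmap : Set.MapsTo f rightHalfPlane G) : BohrInequality G a (69 / 40) := by
  set H := convexHull ℝ G
  have hHo : IsOpen H := hG.convexHull
  have hmapH : ∀ s ∈ rightHalfPlane, f s ∈ H := fun s hs => subset_convexHull ℝ G (hmap hs)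
  obtain ⟨q, hq, hdist⟩ := isClosed_frontier.exists_infDist_eq_dist hfr (a 1)
  have hqH : q ∉ H := fun h => by
    rw [hHo.frontier_eq] at hq
    exact hq.2 h
  obtain ⟨φ, hφ⟩ := geometric_hahn_banach_point_open (convex_convexHull ℝ G) hHo hqH
  obtain ⟨u, hu⟩ := exists_re_mul_eq φ
  have hone : (1 : ℂ) ∈ rightHalfPlane := by simp [rightHalfPlane]
  have hu0 : 0 < ‖u‖ := by
    rw [norm_pos_iff]
    rintro rfl
    simpa [hu] using hφ _ (hmapH 1 hone)
  -- The coefficients of `u * (f - q)`: the constant `q` is the Dirichlet series `q • delta`, so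
  -- only `n = 1` is shifted.
  let b : ℕ → ℂ := u • (a - q • LSeries.delta)
  have hsum : ∀ t : ℝ, LSeriesSummable a ((3 : ℝ) + t * Complex.I) := fun t =>
    hser.lseriesSummable (by simp; norm_num)
  have hδ : ∀ s, LSeriesSummable LSeries.delta s := fun s => by
    refine summable_of_ne_finset_zero (s := {1}) fun n hn => ?_
    rcases eq_or_ne n 0 with rfl | hn0
    · simp
    · rw [LSeries.term_of_ne_zero hn0]
      simp [LSeries.delta, (Finset.notMem_singleton.1 hn)]
  have hpos : IsMulToeplitzNonneg b := by
    refine isMulToeplitzNonneg_of_re_nonneg (f := fun s => u * (f s - q)) (c := 3) ?_ ?_ ?_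
      (by norm_num) ?_ ?_
    · exact (hf.sub_const q).const_mul u
    · intro ε hε
      obtain ⟨C, hC⟩ := hb ε hε
      refine ⟨‖u‖ * (C + ‖q‖), fun s hs => ?_⟩
      rw [norm_mul]
      gcongr
      exact (norm_sub_le _ _).trans (by gcongr; exact hC s hs)
    · intro s hs
      have := hφ _ (hmapH s hs)
      rw [hu, hu] at this
      rw [mul_sub, Complex.sub_re]
      linarith
    · have := hsum 0
      simp only [Complex.ofReal_zero, zero_mul, add_zero] at this
      exact (this.sub ((hδ _).smul q)).smul u
    · intro t
      rw [hser.eq_LSeries (by simp [rightHalfPlane]) (hsum t), LSeries_smul,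
        LSeries_sub (hsum t) ((hδ _).smul q), LSeries_smul, LSeries_delta]
      simp
  have hb1 : b 1 = u * (a 1 - q) := by simp [b, LSeries.delta]
  have hbn : ∀ n, 1 < n → b n = u * a n := fun n hn => by
    simp [b, LSeries.delta, hn.ne']
  set d := Metric.infDist (a 1) (frontier H)
  have hbound : ∀ N, ∑ n ∈ Finset.range N, ‖a (n + 2)‖ / ((n + 2 : ℕ) : ℝ) ^ (69 / 40 : ℝ)
      ≤ 0.99 * d := by
    intro N
    have h1 := hpos.sum_norm_rpow_le (N + 2)
    rw [Finset.sum_filter, Finset.sum_range_succ', Finset.sum_range_succ'] at h1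
    have h2 : ∑ n ∈ Finset.range N, (if 1 < n + 1 + 1 then
        ‖b (n + 1 + 1)‖ * ((n + 1 + 1 : ℕ) : ℝ) ^ (-(69 / 40 : ℝ)) else 0)
        = ‖u‖ * ∑ n ∈ Finset.range N, ‖a (n + 2)‖ / ((n + 2 : ℕ) : ℝ) ^ (69 / 40 : ℝ) := by
      rw [Finset.mul_sum]
      refine Finset.sum_congr rfl fun n _ => ?_
      rw [if_pos (by omega), hbn _ (by omega), norm_mul, Real.rpow_neg (by positivity), mul_assoc,
        ← div_eq_mul_inv]
    rw [h2] at h1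
    simp only [zero_add, lt_irrefl, if_false, add_zero, not_lt_zero] at h1
    have h3 : (b 1).re ≤ ‖u‖ * d := by
      rw [hb1, hdist, dist_eq_norm, ← norm_mul]
      exact Complex.re_le_norm _
    refine le_of_mul_le_mul_left (a := ‖u‖) ?_ hu0
    linarith
  have hnonneg : ∀ n : ℕ, 0 ≤ ‖a (n + 2)‖ / ((n + 2 : ℕ) : ℝ) ^ (69 / 40 : ℝ) :=
    fun n => by positivity
  -- Strictness needs `d > 0`. If `d = 0`, the bound kills every `a n` with `n ≥ 2`, so `f 1 = a 1 =
  -- q`, which lies outside the open convex hull.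
  have hd : 0 < d := by
    refine lt_of_le_of_ne Metric.infDist_nonneg fun h0 => ?_
    have hq1 : a 1 = q := dist_eq_zero.1 (by rw [← hdist]; exact h0.symm)
    have hz : ∀ n, a (n + 2) = 0 := by
      intro n
      have h1 := hbound (n + 1)
      rw [← h0, mul_zero] at h1
      have h2 := (Finset.sum_eq_zero_iff_of_nonneg fun i _ => hnonneg i).1
        (le_antisymm h1 (Finset.sum_nonneg fun i _ => hnonneg i)) n (by simp)
      have h3 : (((n + 2 : ℕ) : ℝ) ^ (69 / 40 : ℝ)) ≠ 0 := by positivity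
      rw [div_eq_zero_iff, or_iff_left h3, norm_eq_zero] at h2
      exact h2
    have hf1 : f 1 = q := by
      refine tendsto_nhds_unique (hser 1 hone) (tendsto_const_nhds.congr' ?_)
      filter_upwards [eventually_ge_atTop 1] with N hN
      rw [Finset.sum_eq_single_of_mem 1 (by simpa using hN)]
      · simp [hq1]
      · intro n hn hn1
        obtain ⟨m, rfl⟩ : ∃ m, n = m + 2 := ⟨n - 2, by have := Finset.mem_Icc.1 hn; omega⟩
        rw [hz, zero_div]
    exact hqH (hf1 ▸ hmapH 1 hone)
  refine ⟨summable_of_sum_range_le hnonneg hbound, ?_⟩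
  refine (Real.tsum_le_of_sum_range_le hnonneg hbound).trans_lt ?_
  linarith

theorem bohrInequality_of_memHInfty {G : Set ℂ} (hG : IsOpen G)
    (hfr : (frontier (convexHull ℝ G)).Nonempty) {f : ℂ → ℂ} {a : ℕ → ℂ}
    (hser : HasDirichletSeries f a) (hf : MemHInfty f)
    (hmap : Set.MapsTo f rightHalfPlane G) : BohrInequality G a (69 / 40) := by
  obtain ⟨hd, C, hC⟩ := hf
  exact bohrInequality_of_mapsTo hG hfr hser hd
    (fun ε hε => ⟨C, fun s hs => hC s (hε.trans_le hs)⟩) hmap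

/-- Absolute convergence at `ε` dominates the series on all of `Re s ≥ ε`, so boundedness on the
whole half-plane is not required. -/
theorem bohrInequality_of_convergesAbsolutely {G : Set ℂ} (hG : IsOpen G)
    (hfr : (frontier (convexHull ℝ G)).Nonempty) {f : ℂ → ℂ} {a : ℕ → ℂ}
    (hser : HasDirichletSeries f a) (ha : ConvergesAbsolutely a)
    (hmap : Set.MapsTo f rightHalfPlane G) : BohrInequality G a (69 / 40) := by
  have heq : ∀ s ∈ rightHalfPlane, f s = LSeries a s := fun s hs =>
    hser.eq_LSeries hs (ha.lseriesSummable hs)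
  have hab : LSeries.abscissaOfAbsConv a ≤ (0 : ℝ) :=
    LSeries.abscissaOfAbsConv_le_of_forall_lt_LSeriesSummable fun y hy =>
      ha.lseriesSummable (by simpa [rightHalfPlane] using hy)
  refine bohrInequality_of_mapsTo hG hfr hser ?_ ?_ hmap
  · refine ((LSeries_differentiableOn a).mono fun s hs => ?_).congr heq
    exact hab.trans_lt (EReal.coe_lt_coe_iff.2 hs)
  · intro ε hε
    have hε' : (ε : ℂ) ∈ rightHalfPlane := by simpa [rightHalfPlane] using hε
    refine ⟨∑' n, ‖LSeries.term a ε n‖, fun s hs => ?_⟩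
    have hsre : s ∈ rightHalfPlane := hε.trans_le hs
    rw [heq s hsre]
    have h1 := (ha.lseriesSummable hsre).norm
    exact (norm_tsum_le_tsum_norm h1).trans
      (h1.tsum_le_tsum (fun n => LSeries.norm_term_le_of_re_le_re a (by simpa using hs) n)
        (ha.lseriesSummable hε').norm)

/-! ### The lower bound: disc automorphisms in `2 ^ (-s)` -/

/-- The Taylor coefficients at `0` of `z ↦ c + w * (α - z) / (1 - α * z)`. -/
def discMapCoeff (c w : ℂ) (α : ℝ) : ℕ → ℂ
  | 0 => c + w * α
  | k + 1 => -(w * (1 - α ^ 2) * α ^ k)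

theorem hasSum_discMapCoeff (c w : ℂ) {α : ℝ} (h0 : 0 ≤ α) (h1 : α < 1) {z : ℂ} (hz : ‖z‖ < 1) :
    HasSum (fun k => discMapCoeff c w α k * z ^ k) (c + w * ((α - z) / (1 - α * z))) := by
  have hαz : ‖(α : ℂ) * z‖ < 1 := by
    rw [norm_mul, Complex.norm_real, Real.norm_of_nonneg h0]
    nlinarith [norm_nonneg z]
  have hne : (1 : ℂ) - α * z ≠ 0 := fun h => by
    rw [← sub_eq_zero.1 h, norm_one] at hαz
    exact lt_irrefl _ hαz
  have h2 := (hasSum_geometric_of_norm_lt_one hαz).mul_left (-(w * (1 - α ^ 2) * z))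
  have h3 : HasSum (fun k => discMapCoeff c w α (k + 1) * z ^ (k + 1))
      (-(w * (1 - α ^ 2) * z) * (1 - α * z)⁻¹) := by
    refine (congrArg (fun g => HasSum g _) (funext fun k => ?_)).mpr h2
    simp only [discMapCoeff]
    ring
  have h4 := HasSum.zero_add (f := fun k => discMapCoeff c w α k * z ^ k) h3
  convert h4 using 1
  simp only [discMapCoeff]
  field_simp
  ring

theorem hasSum_norm_discMapCoeff (c w : ℂ) {α : ℝ} (h0 : 0 ≤ α) (h1 : α < 1) {x : ℝ} (hx : 0 ≤ x)
    (hαx : α * x < 1) : HasSum (fun k => ‖discMapCoeff c w α k‖ * x ^ k)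
      (‖c + w * α‖ + ‖w‖ * (1 - α ^ 2) * x * (1 - α * x)⁻¹) := by
  have h2 := (hasSum_geometric_of_lt_one (mul_nonneg h0 hx) hαx).mul_left (‖w‖ * (1 - α ^ 2) * x)
  have h3 : HasSum (fun k => ‖discMapCoeff c w α (k + 1)‖ * x ^ (k + 1))
      (‖w‖ * (1 - α ^ 2) * x * (1 - α * x)⁻¹) := by
    refine (congrArg (fun g => HasSum g _) (funext fun k => ?_)).mpr h2
    have h4 : ((1 : ℂ) - α ^ 2) = ((1 - α ^ 2 : ℝ) : ℂ) := by push_cast; ring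
    simp only [discMapCoeff]
    rw [norm_neg, norm_mul, norm_mul, norm_pow, h4, Complex.norm_real, Complex.norm_real,
      Real.norm_of_nonneg h0, Real.norm_of_nonneg (by nlinarith)]
    ring
  have h4 := HasSum.zero_add (f := fun k => ‖discMapCoeff c w α k‖ * x ^ k) h3
  simpa [discMapCoeff] using h4

theorem norm_discAut_lt_one {α : ℝ} (h0 : 0 ≤ α) (h1 : α < 1) {z : ℂ} (hz : ‖z‖ < 1) :
    ‖(α - z) / (1 - α * z)‖ < 1 := by
  have hsq : ‖z‖ ^ 2 < 1 := by nlinarith [norm_nonneg z]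
  -- The difference of the two sides is `(1 - α ^ 2) * (1 - ‖z‖ ^ 2)`.
  have key : ‖α - z‖ ^ 2 < ‖1 - α * z‖ ^ 2 := by
    rw [Complex.sq_norm, Complex.normSq_apply] at hsq ⊢
    rw [Complex.sq_norm, Complex.normSq_apply]
    simp
    nlinarith [mul_pos (show 0 < 1 - α ^ 2 by nlinarith) (sub_pos.2 hsq)]
  have h2 := lt_of_pow_lt_pow_left₀ 2 (norm_nonneg _) key
  rw [norm_div, div_lt_one ((norm_nonneg _).trans_lt h2)]
  exact h2

/-- The Dirichlet coefficients supported on the powers of two. -/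
noncomputable def powTwoCoeff (b : ℕ → ℂ) : ℕ → ℂ := Function.extend (fun k => 2 ^ k) b 0

theorem pow_two_injective : Function.Injective fun k : ℕ => 2 ^ k :=
  Nat.pow_right_injective le_rfl

theorem powTwoCoeff_pow (b : ℕ → ℂ) (k : ℕ) : powTwoCoeff b (2 ^ k) = b k :=
  pow_two_injective.extend_apply b 0 k

theorem powTwoCoeff_eq_zero (b : ℕ → ℂ) {n : ℕ} (hn : n ∉ Set.range fun k : ℕ => 2 ^ k) :
    powTwoCoeff b n = 0 := Function.extend_apply' _ _ _ fun h => hn h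

theorem powTwoCoeff_zero (b : ℕ → ℂ) : powTwoCoeff b 0 = 0 :=
  powTwoCoeff_eq_zero b fun ⟨k, hk⟩ => pow_ne_zero k two_ne_zero hk

theorem hasSum_powTwoCoeff {b : ℕ → ℂ} {s S : ℂ}
    (h : HasSum (fun k => b k * ((2 : ℂ) ^ (-s)) ^ k) S) :
    HasSum (fun n : ℕ => powTwoCoeff b n / (n : ℂ) ^ s) S := by
  rw [← pow_two_injective.hasSum_iff]
  · refine (congrArg (fun g => HasSum g _) (funext fun k => ?_)).mpr h
    have h1 : ((2 ^ k : ℕ) : ℂ) ^ s = ((2 : ℂ) ^ s) ^ k := by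
      induction k with
      | zero => simp
      | succ k ih => rw [pow_succ, Nat.cast_mul, Complex.natCast_mul_natCast_cpow, ih, pow_succ]; simp
    simp only [Function.comp]
    rw [powTwoCoeff_pow, h1, Complex.cpow_neg, inv_pow, div_eq_mul_inv]
  · intro n hn
    rw [powTwoCoeff_eq_zero b hn, zero_div]

theorem hasSum_norm_powTwoCoeff {b : ℕ → ℂ} {σ S : ℝ}
    (h : HasSum (fun k => ‖b k‖ * (((2 : ℝ) ^ σ)⁻¹) ^ k) S) :
    HasSum (fun n : ℕ => ‖powTwoCoeff b n‖ / (n : ℝ) ^ σ) S := by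
  rw [← pow_two_injective.hasSum_iff]
  · refine (congrArg (fun g => HasSum g _) (funext fun k => ?_)).mpr h
    have h1 : ((2 ^ k : ℕ) : ℝ) ^ σ = ((2 : ℝ) ^ σ) ^ k := by
      rw [Nat.cast_pow, Nat.cast_ofNat, ← Real.rpow_natCast, ← Real.rpow_natCast,
        ← Real.rpow_mul (by norm_num), ← Real.rpow_mul (by norm_num), mul_comm]
    simp only [Function.comp]
    rw [powTwoCoeff_pow, h1, inv_pow, div_eq_mul_inv]
  · intro n hn
    rw [powTwoCoeff_eq_zero b hn, norm_zero, zero_div]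

/-- The test function takes values in the disc touching `p`, with `a 1` on the radius towards `p`.
It is both absolutely convergent and bounded, so it belongs to all three classes of series. -/
theorem log_three_div_log_two_le {G : Set ℂ} {p : ℂ} (hp : IsRegularPointOfConvexity G p) {σ : ℝ}
    (hσ : 0 ≤ σ) (h : ∀ (f : ℂ → ℂ) (a : ℕ → ℂ), HasDirichletSeries f a → ConvergesAbsolutely a →
      MemHInfty f → Set.MapsTo f rightHalfPlane G → BohrInequality G a σ) :
    Real.log 3 / Real.log 2 ≤ σ := by
  obtain ⟨⟨-, hpH⟩, c, r, hr, hball, hpc⟩ := hp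
  rw [frontier_ball c hr.ne', mem_sphere_iff_norm] at hpc
  by_contra! hlt
  set x : ℝ := (2 : ℝ) ^ σ with hx
  have hx1 : 1 ≤ x := Real.one_le_rpow (by norm_num) hσ
  have hx3 : x < 3 := by
    rw [lt_div_iff₀ (Real.log_pos (by norm_num))] at hlt
    rw [hx, Real.rpow_def_of_pos (by norm_num), ← Real.lt_log_iff_exp_lt (by norm_num), mul_comm]
    exact hlt
  -- The Bohr sum is `r * (1 - α ^ 2) / (x - α)` and the distance from `a 1` to `p` is `r * (1 -
  -- α)`; this `α` makes them equal. It is below `1` exactly because `x < 3`.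
  set α : ℝ := (x - 1) / 2 with hα
  have hα0 : 0 ≤ α := by linarith
  have hα1 : α < 1 := by linarith
  set b := discMapCoeff c (p - c) α with hb
  set F : ℂ → ℂ := fun s => c + (p - c) * ((α - (2 : ℂ) ^ (-s)) / (1 - α * (2 : ℂ) ^ (-s))) with hF
  have hz : ∀ s ∈ rightHalfPlane, ‖(2 : ℂ) ^ (-s)‖ < 1 := by
    intro s hs
    have := Complex.norm_cpow_eq_rpow_re_of_pos (x := 2) (by norm_num) (-s)
    push_cast at this
    rw [this]
    exact Real.rpow_lt_one_of_one_lt_of_neg (by norm_num) (by simpa [rightHalfPlane] using hs)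
  have hsum : ∀ s ∈ rightHalfPlane, HasSum (fun n : ℕ => powTwoCoeff b n / (n : ℂ) ^ s) (F s) :=
    fun s hs => hasSum_powTwoCoeff (hasSum_discMapCoeff c (p - c) hα0 hα1 (hz s hs))
  have hser : HasDirichletSeries F (powTwoCoeff b) := by
    intro s hs
    refine ((hsum s hs).tendsto_sum_nat.comp (tendsto_add_atTop_nat 1)).congr fun N => ?_
    refine (Finset.sum_subset (fun n hn => ?_) fun n hn hn' => ?_).symm
    · exact Finset.mem_range.2 (Nat.lt_succ_of_le (Finset.mem_Icc.1 hn).2)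
    · obtain rfl : n = 0 := by
        have : n < N + 1 := Finset.mem_range.1 hn
        rw [Finset.mem_Icc] at hn'
        omega
      rw [powTwoCoeff_zero, zero_div]
  have habs : ConvergesAbsolutely (powTwoCoeff b) := fun s hs =>
    (summable_nat_add_iff (f := fun n : ℕ => ‖powTwoCoeff b n / (n : ℂ) ^ s‖) 1).2
      (hsum s hs).summable.norm
  have hlt1 : ∀ s ∈ rightHalfPlane, ‖F s - c‖ < r := by
    intro s hs
    have h1 := norm_discAut_lt_one hα0 hα1 (hz s hs)
    simp only [hF, add_sub_cancel_left, norm_mul, hpc]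
    exact mul_lt_of_lt_one_right hr h1
  have hmem : MemHInfty F := by
    refine ⟨fun s hs => DifferentiableAt.differentiableWithinAt ?_, ‖c‖ + r, fun s hs => ?_⟩
    · have hne : (1 : ℂ) - α * (2 : ℂ) ^ (-s) ≠ 0 := by
        intro h0
        have h1 : ‖(α : ℂ) * (2 : ℂ) ^ (-s)‖ < 1 := by
          rw [norm_mul, Complex.norm_real, Real.norm_of_nonneg hα0]
          nlinarith [hz s hs, norm_nonneg ((2 : ℂ) ^ (-s))]
        rw [← sub_eq_zero.1 h0, norm_one] at h1
        exact lt_irrefl _ h1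
      have hd : DifferentiableAt ℂ (fun s : ℂ => (2 : ℂ) ^ (-s)) s :=
        (differentiableAt_id.neg).const_cpow (Or.inl two_ne_zero)
      exact (((hd.const_sub _).div ((hd.const_mul _).const_sub _) hne).const_mul _).const_add _
    · have h1 := norm_add_le (F s - c) c
      rw [sub_add_cancel] at h1
      linarith [hlt1 s hs]
  have hmap : Set.MapsTo F rightHalfPlane G := fun s hs =>
    hball (mem_ball_iff_norm.2 (hlt1 s hs))
  obtain ⟨-, hB⟩ := h F _ hser habs hmem hmap
  have hαx : α * x⁻¹ < 1 := by
    rw [← div_eq_mul_inv, div_lt_one (by linarith)]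
    linarith
  have htot := hasSum_norm_powTwoCoeff (hasSum_norm_discMapCoeff c (p - c) hα0 hα1
    (inv_nonneg.2 (by linarith)) hαx)
  -- Dropping the indices `0` and `1` leaves the Bohr sum, which starts at `n = 2`.
  have htail := (hasSum_nat_add_iff' 2).2 htot
  have hA1 : powTwoCoeff b 1 = c + (p - c) * α := by
    simpa [hb, discMapCoeff] using powTwoCoeff_pow b 0
  have hB2 : Metric.infDist (powTwoCoeff b 1) (frontier (convexHull ℝ G)) ≤ r * (1 - α) := by
    refine (Metric.infDist_le_dist_of_mem hpH).trans (le_of_eq ?_)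
    have h1 : c + (p - c) * α - p = -((p - c) * ((1 - α : ℝ) : ℂ)) := by push_cast; ring
    rw [hA1, dist_eq_norm, h1, norm_neg, norm_mul, hpc, Complex.norm_real,
      Real.norm_of_nonneg (by linarith)]
  rw [htail.tsum_eq, Finset.sum_range_succ, Finset.sum_range_one, ← hb, powTwoCoeff_zero, hA1,
    norm_zero, zero_div, zero_add, Nat.cast_one, Real.one_rpow, div_one, add_sub_cancel_left,
    hpc] at hB
  have hval : r * (1 - α ^ 2) * x⁻¹ * (1 - α * x⁻¹)⁻¹ = r * (1 - α) := by
    have hx0 : x ≠ 0 := by linarith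
    have h1 : 1 - α * x⁻¹ = (1 + α) * x⁻¹ := by
      rw [hα]
      field_simp
      ring
    have h2 : 1 + α ≠ 0 := by linarith
    rw [h1]
    field_simp
    ring
  rw [hA1] at hB2
  rw [← hx, hval] at hB
  exact hB.not_ge hB2

end BohrDirichlet

/-! ### Bounds for the three abscissas -/

theorem corollary3p2 (G : Set ℂ) (hG_open : IsOpen G) (hG_conn : IsConnected G)
    (hG_reg : ∃ p : ℂ, BohrDirichlet.IsRegularPointOfConvexity G p) :
    (Bornology.IsBounded G →
      Real.log 3 / Real.log 2 ≤ BohrDirichlet.bohrAbscissa G ∧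
        BohrDirichlet.bohrAbscissa G < 1.7267) ∧
    (Real.log 3 / Real.log 2 ≤ BohrDirichlet.bohrAbscissaAbs G ∧
      BohrDirichlet.bohrAbscissaAbs G < 1.7267) ∧
    (Real.log 3 / Real.log 2 ≤ BohrDirichlet.bohrAbscissaAbsBounded G ∧
      BohrDirichlet.bohrAbscissaAbsBounded G < 1.7267) := by
  obtain ⟨p, hp⟩ := hG_reg
  have hfr : (frontier (convexHull ℝ G)).Nonempty := ⟨p, hp.1.2⟩
  -- Membership of `69 / 40 = 1.725` bounds the infimum strictly below `1.7267`, and also makes the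
  -- set nonempty, as the lower bound for a real `sInf` requires.
  have bounds : ∀ E : Set ℝ, (69 / 40 : ℝ) ∈ E →
      (∀ σ ∈ E, Real.log 3 / Real.log 2 ≤ σ) → (∀ σ ∈ E, 0 ≤ σ) →
      Real.log 3 / Real.log 2 ≤ sInf E ∧ sInf E < 1.7267 := fun E h1 h2 h3 =>
    ⟨le_csInf ⟨_, h1⟩ h2, (csInf_le ⟨0, h3⟩ h1).trans_lt (by norm_num)⟩
  refine ⟨fun _ => bounds _ ⟨by norm_num, ?_⟩ ?_ fun σ h => h.1,
    bounds _ ⟨by norm_num, ?_⟩ ?_ fun σ h => h.1, bounds _ ⟨by norm_num, ?_⟩ ?_ fun σ h => h.1⟩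
  · exact fun f a hf hb hm => BohrDirichlet.bohrInequality_of_memHInfty hG_open hfr hf hb hm
  · exact fun σ h => BohrDirichlet.log_three_div_log_two_le hp h.1 fun f a hf _ hb hm => h.2 f a hf hb hm
  · exact fun f a hf ha hm => BohrDirichlet.bohrInequality_of_convergesAbsolutely hG_open hfr hf ha hm
  · exact fun σ h => BohrDirichlet.log_three_div_log_two_le hp h.1 fun f a hf ha _ hm => h.2 f a hf ha hm
  · exact fun f a hf ha _ hm => BohrDirichlet.bohrInequality_of_convergesAbsolutely hG_open hfr hf ha hm
  · exact fun σ h => BohrDirichlet.log_three_div_log_two_le hp h.1 h.2
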